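/- For $k\ge 1$ define graphs as follows. * The chain of boxes $B_k$ consists of a path $v_0,v_1,\dots,v_{2k-1}$ together with, for each $0\le i<k$, two new vertices $a_i,b_i$ and the path $v_{2i},a_i,b_i,v_{2i+1}$. * The gadget $H_k$ is obtained from the twelve-cycle with vertices, in cyclic order, $a,x_1,w_1,u,w_2,x_2,b,y_2,z_2,v,z_1,y_1$ by adding the edge $\{a,b\}$ and four disjoint copies of $B_k$, identifying the ends $(v_0,v_{2k-1})$ of the copies with $(w_1,a)$, $(a,z_1)$, $(w_2,b)$ and $(b,z_2)$ respectively. * The graph $G_k$ consists of four disjoint copies $H^1,\dots,H^4$ of $H_k$ and four further vertices $t_1,\dots,t_4$, where $t_i$ is joined to the vertex $u$ of $H^i$ and to the vertex $v$ of $H^{i-1}$ (indices modulo $4$). For a graph $G=(V,E)$ let $\Omega$ be the set of perfect matchings $\mathcal P$ and near-perfect matchings (those with exactly two unmatched vertices) of $G$. The hole pattern of $M\in\Omega$ is its set of unmatched vertices. The Broder chain on $\Omega$ moves from $M$ as follows. If $M$ is perfect, remove a uniformly random edge of $M$. If $M$ has holes $p,q$, choose a uniformly random $x\in V$. If $x\in\{p,q\}$,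 add the edge $\{p,q\}$ if it is an edge of $G$, and otherwise stay. If $x\notin\{p,q\}$, let $y$ be the partner of $x$ in $M$ and choose $h\in\{p,q\}$ uniformly at random; replace $\{x,y\}$ by $\{x,h\}$ if $x$ and $h$ are adjacent, and otherwise stay. A Markov chain on $\Omega$ is of JSV type if, for some weight function $w:\Omega\to(0,\infty)$ with $w(M)$ depending only on the hole pattern of $M$, it moves from $M$ by drawing a proposal $M'$ from the Broder chain and accepting it with probability $\min\{1,w(M')/w(M)\}$, staying at $M$ otherwise. The mixing time of a chain with transition matrix $P$ and stationary distribution $\pi$ is $T_{\mathrm{mix}}=\max_{i}\min\{t: \tfrac12\sum_{j}|P^t(i,j)-\pi(j)|\le \tfrac14\}$. **Theorem.** The graph $G_k$ has $n=64k+20$ vertices for every $k\ge1$, and there are constants $c>0$ and $K\ge 1$ such that for every $k\ge K$ the following holds. Every Markov chain of JSV type on $G_k$ has a unique stationary distribution $\pi$, and either $\pi(\mathcal P)\le \exp(-cn)$ or $T_{\mathrm{mix}}\ge\exp(cn)$. -/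

import Mathlib

open scoped ENNReal Matrix

noncomputable section

namespace JSV

/-! ### Finite Markov chains -/

section MarkovChain

variable {S : Type*} [Fintype S] [DecidableEq S]

/-- `π` is a stationary distribution of the chain with transition matrix `P`. -/
def IsStationary (P : Matrix S S ℝ) (π : S → ℝ) : Prop :=
  π ∈ stdSimplex ℝ S ∧ π ᵥ* P = π

/-- Total variation distance. -/
def dTV (μ ν : S → ℝ) : ℝ := (1 / 2) * ∑ x, |μ x - ν x|

/-- The mixing time: the maximum over the starting states `i` of the least `t` such that
`P ^ t (i, ·)` is within total variation distance `1 / 4` of `π` (`⊤` if there is no such `t`). -/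
def mixingTime (P : Matrix S S ℝ) (π : S → ℝ) : ℕ∞ :=
  ⨆ i : S, ⨅ t : {t : ℕ // dTV ((P ^ t) i) π ≤ 1 / 4}, ((t : ℕ) : ℕ∞)

end MarkovChain

/-! ### The Broder chain and chains of JSV type on a graph -/

section Chain

variable {V : Type*} [Fintype V] [DecidableEq V]

/-- A set `M` of edges of `G`, no two of which share a vertex. -/
def IsMatching (G : SimpleGraph V) (M : Finset (Sym2 V)) : Prop :=
  (∀ e ∈ M, e ∈ G.edgeSet) ∧ ∀ e ∈ M, ∀ f ∈ M, ∀ v, v ∈ e → v ∈ f → e = f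

/-- The holes (unmatched vertices) of `M`. -/
def holes (M : Finset (Sym2 V)) : Finset V :=
  Finset.univ.filter fun v => ∀ e ∈ M, v ∉ e

/-- The state space: perfect matchings (no hole) and near-perfect matchings (exactly two holes). -/
def State (G : SimpleGraph V) : Type _ :=
  {M : Finset (Sym2 V) // IsMatching G M ∧ ((holes M).card = 0 ∨ (holes M).card = 2)}

instance (G : SimpleGraph V) : DecidableEq (State G) :=
  inferInstanceAs (DecidableEq {M : Finset (Sym2 V) //
    IsMatching G M ∧ ((holes M).card = 0 ∨ (holes M).card = 2)})

open Classical in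
instance (G : SimpleGraph V) : Fintype (State G) :=
  inferInstanceAs (Fintype {M : Finset (Sym2 V) //
    IsMatching G M ∧ ((holes M).card = 0 ∨ (holes M).card = 2)})

/-- The set of perfect matchings. -/
def perfectMatchings (G : SimpleGraph V) : Finset (State G) :=
  Finset.univ.filter fun M => holes M.1 = ∅

open Classical in
/-- The move of the Broder chain from a near-perfect matching `M` when the vertex `x` and the hole
`w` have been chosen. If `x` is a hole, the edge joining the two holes is added, if there is one
(and nothing happens otherwise; `w` is then not used). If `x` is not a hole, the edge of `M` at `x`
is replaced by `{x, w}` provided `x` is adjacent to `w`; otherwise nothing happens. -/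
def nearMove (G : SimpleGraph V) (M : Finset (Sym2 V)) (x w : V) : Finset (Sym2 V) :=
  if x ∈ holes M then
    M ∪ Finset.univ.filter fun e => e ∈ G.edgeSet ∧ ∀ z ∈ e, z ∈ holes M
  else if G.Adj x w then
    insert s(x, w) (M.filter fun e => x ∉ e)
  else M

/-- Transition probabilities of the Broder chain. From a perfect matching `M` a uniformly random
edge of `M` is removed; from a near-perfect matching, `nearMove` is applied with a uniformly random
vertex `x` and an independent uniformly random hole `w`. -/
def broder (G : SimpleGraph V) (M M' : State G) : ℝ :=
  if holes M.1 = ∅ then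
    ((M.1.filter fun e => M'.1 = M.1.erase e).card : ℝ) / (M.1.card : ℝ)
  else
    (((Finset.univ ×ˢ holes M.1).filter fun p : V × V => M'.1 = nearMove G M.1 p.1 p.2).card : ℝ) /
      ((Fintype.card V : ℝ) * ((holes M.1).card : ℝ))

/-- The Broder chain with a Metropolis filter for the weight function `w`: a proposal `M'` from `M`
is accepted with probability `min 1 (w M' / w M)`, and otherwise the chain stays at `M`. -/
def metropolis (G : SimpleGraph V) (w : State G → ℝ) : Matrix (State G) (State G) ℝ :=
  fun M M' => broder G M M' * min 1 (w M' / w M) +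
    if M = M' then ∑ N : State G, broder G M N * (1 - min 1 (w N / w M)) else 0

/-- `P` is the transition matrix of a chain of JSV type: the Broder chain with a Metropolis filter
for some (positive) weight function depending only on the hole pattern. -/
def IsJSVType (G : SimpleGraph V) (P : Matrix (State G) (State G) ℝ) : Prop :=
  ∃ w : State G → ℝ, (∀ M, 0 < w M) ∧ (∀ M M', holes M.1 = holes M'.1 → w M = w M') ∧
    P = metropolis G w

end Chain

/-! ### The graphs -/

/-- Vertices of the chain of boxes of length `k`: a path `v 0, …, v (2k-1)` and, for each `i < k`,
two additional vertices `a i`, `b i`. -/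
inductive BoxVertex (k : ℕ)
  | v (i : Fin (2 * k))
  | a (i : Fin k)
  | b (i : Fin k)
  deriving DecidableEq, Fintype

/-- The chain of boxes: the path `v 0, …, v (2k-1)` and the paths
`v (2i), a i, b i, v (2i+1)` for `i < k`. -/
def boxChain (k : ℕ) : SimpleGraph (BoxVertex k) :=
  SimpleGraph.fromRel fun p q => match p, q with
    | .v i, .v j => (i : ℕ) + 1 = j
    | .v i, .a j => (i : ℕ) = 2 * j
    | .a i, .b j => i = j
    | .b i, .v j => (j : ℕ) = 2 * i + 1
    | _, _ => False

/-- Whether a vertex is an end `v 0` or `v (2k-1)` of the chain of boxes. -/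
def BoxVertex.IsEnd {k : ℕ} : BoxVertex k → Prop
  | .v i => (i : ℕ) = 0 ∨ (i : ℕ) + 1 = 2 * k
  | _ => False

instance {k : ℕ} : DecidablePred (BoxVertex.IsEnd (k := k)) := fun p =>
  match p with
  | .v i => inferInstanceAs (Decidable ((i : ℕ) = 0 ∨ (i : ℕ) + 1 = 2 * k))
  | .a _ => inferInstanceAs (Decidable False)
  | .b _ => inferInstanceAs (Decidable False)

/-- Vertices of the torpid mixing gadget: the vertices of a twelve-cycle, in cyclic order
`a, x₁, w₁, u, w₂, x₂, b, y₂, z₂, v, z₁, y₁` (numbered from `0` to `11`), and the vertices other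
than the two ends of four chains of boxes. -/
inductive GadgetVertex (k : ℕ)
  | cyc (i : Fin 12)
  | inner (j : Fin 4) (p : {p : BoxVertex k // ¬ p.IsEnd})
  deriving DecidableEq, Fintype

/-- The position on the twelve-cycle with which `v 0` of the `j`-th chain of boxes is identified:
`w₁`, `a`, `w₂`, `b`. -/
def chainStart : Fin 4 → Fin 12 := ![2, 0, 4, 6]

/-- The position on the twelve-cycle with which `v (2k-1)` of the `j`-th chain of boxes is
identified: `a`, `z₁`, `b`, `z₂`. -/
def chainEnd : Fin 4 → Fin 12 := ![0, 10, 6, 8]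

/-- The vertex of the gadget that the vertex `p` of the `j`-th chain of boxes becomes. -/
def chainMap (k : ℕ) (j : Fin 4) (p : BoxVertex k) : GadgetVertex k :=
  if h : p.IsEnd then
    .cyc (if ∃ i : Fin (2 * k), p = .v i ∧ (i : ℕ) = 0 then chainStart j else chainEnd j)
  else .inner j ⟨p, h⟩

/-- The torpid mixing gadget: a twelve-cycle, the chord `{a, b}`, and four chains of boxes
joining `w₁` to `a`, `a` to `z₁`, `w₂` to `b` and `b` to `z₂`. -/
def gadget (k : ℕ) : SimpleGraph (GadgetVertex k) :=
  SimpleGraph.fromRel fun p q =>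
    (∃ i j : Fin 12, (SimpleGraph.cycleGraph 12).Adj i j ∧ p = .cyc i ∧ q = .cyc j) ∨
    (p = .cyc 0 ∧ q = .cyc 6) ∨
    (∃ (j : Fin 4) (r s : BoxVertex k), (boxChain k).Adj r s ∧
      p = chainMap k j r ∧ q = chainMap k j s)

/-- Vertices of the counterexample graph: `t 0, …, t 3` and four copies of the gadget. -/
inductive GVertex (k : ℕ)
  | t (i : Fin 4)
  | copy (i : Fin 4) (p : GadgetVertex k)
  deriving DecidableEq, Fintype

/-- The counterexample graph: four copies of the gadget and the vertices `t i` arranged in a circle;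
with `u i`, `v i` the vertices `u`, `v` of the `i`-th copy, `t i` is adjacent to `u i` and to
`v (i - 1)` (indices modulo `4`). -/
def counterexampleGraph (k : ℕ) : SimpleGraph (GVertex k) :=
  SimpleGraph.fromRel fun p q => match p, q with
    | .copy i r, .copy j s => i = j ∧ (gadget k).Adj r s
    | .t i, .copy j r => (r = .cyc 3 ∧ j = i) ∨ (r = .cyc 9 ∧ j = i - 1)
    | _, _ => False

end JSV

end

/-!
Call a copy of the gadget flagged if its vertices `u` and `v` are both matched to the outside. In a
perfect matching the flags alternate around the four copies, and rotating the graph by one copy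
exchanges the two patterns, so the matchings in which at least three copies follow the first pattern
contain exactly half of the stationary mass of the perfect matchings. A move can change a flag only
through a bottleneck: a near-perfect matching whose only hole in the copy is `x₁`, `x₂`, `y₁` or
`y₂`, while the adjacent `w₁`, `w₂`, `z₁` or `z₂` is matched to `u` or `v`. Such a bottleneck forces
the boxes of one chain of the copy to be matched in a single way; rematching that chain in any of
`2 ^ k` other ways does not move the holes, so bottlenecks carry at most a fraction `16 / 2 ^ k` of
the stationary mass, whatever the weights are. Half of the mass of `𝒫` has to flow through them
before the chain is mixed, whence `2 ^ k π(𝒫) ≤ 128 T_mix`.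
-/

open scoped ENNReal Matrix

noncomputable section

namespace JSV

/-! ### Finite Markov chains -/

section FiniteChains

variable {S : Type*} [Fintype S] [DecidableEq S] {P : Matrix S S ℝ} {π : S → ℝ}

/-- Detailed balance: the chain with transition matrix `P` is reversible with respect to the
(not necessarily normalized) weights `π`. -/
def DetailedBalance {S : Type*} (P : Matrix S S ℝ) (π : S → ℝ) : Prop :=
  ∀ i j, π i * P i j = π j * P j i

/-- The chain with transition matrix `P` reaches every state from every state. -/
def IsIrreducibleChain {S : Type*} (P : Matrix S S ℝ) : Prop :=
  ∀ i j, Relation.ReflTransGen (fun i j => 0 < P i j) i j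

/-- The ergodic flow out of `T`: the probability that the chain, started from `π` and run for one
step, starts in `T` and ends outside `T`. -/
def flow (P : Matrix S S ℝ) (π : S → ℝ) (T : Finset S) : ℝ :=
  ∑ i ∈ T, ∑ j ∈ Tᶜ, π i * P i j

theorem DetailedBalance.vecMul (hP : P ∈ Matrix.rowStochastic ℝ S) (hrev : DetailedBalance P π) :
    π ᵥ* P = π := by
  funext j
  calc ∑ i, π i * P i j = ∑ i, π j * P j i := Finset.sum_congr rfl fun i _ => hrev i j
    _ = π j := by rw [← Finset.mul_sum, Matrix.sum_row_of_mem_rowStochastic hP, mul_one]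

-- Where `h` is maximal, it agrees with its average over the successors, so it is maximal at each of
-- them.
theorem IsIrreducibleChain.eq_of_mulVec_eq (hirr : IsIrreducibleChain P)
    (hP : P ∈ Matrix.rowStochastic ℝ S) {h : S → ℝ} (hh : P *ᵥ h = h) (i j : S) : h i = h j := by
  obtain ⟨m, -, hm⟩ := Finset.exists_max_image Finset.univ h ⟨i, Finset.mem_univ i⟩
  have eq_max : ∀ l, h l = h m := by
    intro l
    induction hirr m l with
    | refl => rfl
    | @tail a b _ hab ih =>
      by_contra hb
      have hlt : ∑ l, P a l * h l < ∑ l, P a l * h m :=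
        Finset.sum_lt_sum
          (fun l hl => mul_le_mul_of_nonneg_left (hm l hl) (Matrix.nonneg_of_mem_rowStochastic hP))
          ⟨b, Finset.mem_univ b,
            mul_lt_mul_of_pos_left (lt_of_le_of_ne (hm b (Finset.mem_univ b)) hb) hab⟩
      rw [← Finset.sum_mul, Matrix.sum_row_of_mem_rowStochastic hP, one_mul, ← ih] at hlt
      exact hlt.ne (congrFun hh a)
  rw [eq_max i, eq_max j]

theorem IsIrreducibleChain.eq_of_isStationary (hirr : IsIrreducibleChain P)
    (hP : P ∈ Matrix.rowStochastic ℝ S) (hrev : DetailedBalance P π) (hpos : ∀ i, 0 < π i)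
    (hsum : ∑ i, π i = 1) {ν : S → ℝ} (hν : IsStationary P ν) : ν = π := by
  -- By reversibility the density `ν / π` is harmonic.
  have harmonic : P *ᵥ (fun i => ν i / π i) = fun i => ν i / π i := by
    funext j
    rw [eq_div_iff (hpos j).ne', ← congrFun hν.2 j]
    simp only [Matrix.mulVec, Matrix.vecMul, dotProduct, Finset.sum_mul]
    refine Finset.sum_congr rfl fun i _ => ?_
    rw [mul_right_comm, mul_comm (P j i), ← hrev i j]
    field_simp [(hpos i).ne']
  funext j
  have density : ∀ i, ν i = ν j / π j * π i := fun i => by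
    rw [hirr.eq_of_mulVec_eq hP harmonic j i, div_mul_cancel₀ _ (hpos i).ne']
  have hone : ν j / π j = 1 := by
    rw [← hν.1.2, Finset.sum_congr rfl fun i _ => density i, ← Finset.mul_sum, hsum, mul_one]
  rw [density j, hone, one_mul]

theorem dTV_vecMul_le (hP : P ∈ Matrix.rowStochastic ℝ S) (μ ν : S → ℝ) :
    dTV (μ ᵥ* P) (ν ᵥ* P) ≤ dTV μ ν := by
  refine mul_le_mul_of_nonneg_left ?_ (by norm_num)
  calc ∑ j, |(μ ᵥ* P) j - (ν ᵥ* P) j| = ∑ j, |∑ i, (μ i - ν i) * P i j| := by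
        simp only [Matrix.vecMul, dotProduct, sub_mul, Finset.sum_sub_distrib]
    _ ≤ ∑ j, ∑ i, |μ i - ν i| * P i j := by
        refine Finset.sum_le_sum fun j _ => (Finset.abs_sum_le_sum_abs _ _).trans_eq ?_
        simp only [abs_mul, abs_of_nonneg (Matrix.nonneg_of_mem_rowStochastic hP)]
    _ = ∑ i, |μ i - ν i| := by
        rw [Finset.sum_comm]
        simp only [← Finset.mul_sum, Matrix.sum_row_of_mem_rowStochastic hP, mul_one]

theorem dTV_pow_antitone (hP : P ∈ Matrix.rowStochastic ℝ S) (hπ : π ᵥ* P = π) (i : S) :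
    Antitone fun t : ℕ => dTV ((P ^ t) i) π := by
  refine antitone_nat_of_succ_le fun t => ?_
  calc dTV ((P ^ (t + 1)) i) π = dTV ((P ^ t) i ᵥ* P) (π ᵥ* P) := by rw [hπ, pow_succ]; rfl
    _ ≤ dTV ((P ^ t) i) π := dTV_vecMul_le hP _ _

theorem dTV_pow_le_of_mixingTime_le (hP : P ∈ Matrix.rowStochastic ℝ S) (hπ : π ᵥ* P = π) {t : ℕ}
    (ht : mixingTime P π ≤ t) (i : S) : dTV ((P ^ t) i) π ≤ 1 / 4 := by
  obtain ⟨⟨s, hs⟩, hst⟩ :=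
    iInf_lt_iff.1 ((iSup_le_iff.1 ht i).trans_lt (Nat.cast_lt.2 t.lt_succ_self))
  exact (dTV_pow_antitone hP hπ i (Nat.lt_succ_iff.1 (Nat.cast_lt.1 hst))).trans hs

theorem sum_sub_sum_le_dTV {S : Type*} [Fintype S] {μ ν : S → ℝ} (h : ∑ i, μ i = ∑ i, ν i)
    (T : Finset S) : ∑ i ∈ T, ν i - ∑ i ∈ T, μ i ≤ dTV μ ν := by
  classical
  have on_T : ∑ i ∈ T, ν i - ∑ i ∈ T, μ i ≤ ∑ i ∈ T, |μ i - ν i| := by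
    rw [← Finset.sum_sub_distrib]
    exact Finset.sum_le_sum fun i _ => by rw [abs_sub_comm]; exact le_abs_self _
  have on_compl : ∑ i ∈ Tᶜ, μ i - ∑ i ∈ Tᶜ, ν i ≤ ∑ i ∈ Tᶜ, |μ i - ν i| := by
    rw [← Finset.sum_sub_distrib]
    exact Finset.sum_le_sum fun i _ => le_abs_self _
  unfold dTV
  linarith [Finset.sum_add_sum_compl T μ, Finset.sum_add_sum_compl T ν,
    Finset.sum_add_sum_compl T fun i => |μ i - ν i|]

theorem vecMul_pow (hπ : π ᵥ* P = π) (t : ℕ) : π ᵥ* (P ^ t) = π := by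
  induction t with
  | zero => rw [pow_zero, Matrix.vecMul_one]
  | succ t ih => rw [pow_succ, ← Matrix.vecMul_vecMul, ih, hπ]

-- To be outside `T` after `t + 1` steps the chain must be outside `T` after `t` steps, or leave `T`
-- in the last step; by stationarity the latter has probability at most `flow P π T`.
theorem flow_pow_le (hP : P ∈ Matrix.rowStochastic ℝ S) (h0 : ∀ i, 0 ≤ π i) (hπ : π ᵥ* P = π)
    (T : Finset S) (t : ℕ) : flow (P ^ t) π T ≤ t * flow P π T := by
  have hterm : ∀ t i l, 0 ≤ π i * (P ^ t) i l := fun t i l =>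
    mul_nonneg (h0 i) (Matrix.nonneg_of_mem_rowStochastic (pow_mem hP t))
  induction t with
  | zero =>
    rw [pow_zero, Nat.cast_zero, zero_mul]
    refine Finset.sum_nonpos fun i hi => Finset.sum_nonpos fun j hj => ?_
    rw [Matrix.one_apply_ne (ne_of_mem_of_not_mem hi (Finset.mem_compl.1 hj)), mul_zero]
  | succ t ih =>
    have last_step : flow (P ^ (t + 1)) π T =
        ∑ l, (∑ i ∈ T, π i * (P ^ t) i l) * ∑ j ∈ Tᶜ, P l j := by
      simp only [flow, pow_succ, Matrix.mul_apply, Finset.mul_sum, Finset.sum_mul]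
      rw [Finset.sum_comm, Finset.sum_congr rfl fun j _ => Finset.sum_comm, Finset.sum_comm]
      simp only [mul_assoc]
    have from_inside : ∑ l ∈ T, (∑ i ∈ T, π i * (P ^ t) i l) * ∑ j ∈ Tᶜ, P l j ≤ flow P π T := by
      refine Finset.sum_le_sum fun l _ => ?_
      rw [← Finset.mul_sum]
      refine mul_le_mul_of_nonneg_right ?_
        (Finset.sum_nonneg fun j _ => Matrix.nonneg_of_mem_rowStochastic hP)
      calc ∑ i ∈ T, π i * (P ^ t) i l ≤ ∑ i, π i * (P ^ t) i l :=
            Finset.sum_le_univ_sum_of_nonneg fun i => hterm t i l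
        _ = π l := congrFun (vecMul_pow hπ t) l
    have from_outside :
        ∑ l ∈ Tᶜ, (∑ i ∈ T, π i * (P ^ t) i l) * ∑ j ∈ Tᶜ, P l j ≤ flow (P ^ t) π T := by
      rw [flow, Finset.sum_comm]
      refine Finset.sum_le_sum fun l _ =>
        mul_le_of_le_one_right (Finset.sum_nonneg fun i _ => hterm t i l) ?_
      rw [← Matrix.sum_row_of_mem_rowStochastic hP l]
      exact Finset.sum_le_univ_sum_of_nonneg fun j => Matrix.nonneg_of_mem_rowStochastic hP
    rw [last_step, ← Finset.sum_add_sum_compl T]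
    push_cast
    linarith

theorem flow_compl (hP : P ∈ Matrix.rowStochastic ℝ S) (hπ : π ᵥ* P = π) (T : Finset S) :
    flow P π Tᶜ = flow P π T := by
  have out_T : ∑ i ∈ T, ∑ j, π i * P i j = ∑ i ∈ T, π i := by
    simp only [← Finset.mul_sum, Matrix.sum_row_of_mem_rowStochastic hP, mul_one]
  have into_T : ∑ j ∈ T, ∑ i, π i * P i j = ∑ j ∈ T, π j :=
    Finset.sum_congr rfl fun j _ => congrFun hπ j
  simp only [← Finset.sum_add_sum_compl T (fun i => π _ * P _ i), Finset.sum_add_distrib] at out_T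
  simp only [← Finset.sum_add_sum_compl T (fun i => π i * P i _), Finset.sum_add_distrib] at into_T
  have swap_T : ∑ j ∈ T, ∑ i ∈ T, π i * P i j = ∑ i ∈ T, ∑ j ∈ T, π i * P i j := Finset.sum_comm
  have swap_compl : ∑ j ∈ T, ∑ i ∈ Tᶜ, π i * P i j = ∑ i ∈ Tᶜ, ∑ j ∈ T, π i * P i j :=
    Finset.sum_comm
  rw [flow, flow, compl_compl]
  linarith

theorem IsStationary.min_le_flow (hst : IsStationary P π) (hP : P ∈ Matrix.rowStochastic ℝ S)
    (T : Finset S) {t : ℕ} (ht : mixingTime P π ≤ t) :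
    min (∑ i ∈ T, π i) (∑ i ∈ Tᶜ, π i) ≤ 4 * (t * flow P π T) := by
  -- After the mixing time, every state of `U` has moved to `Uᶜ` with probability at least `1 / 4`.
  have escape : ∀ U : Finset S, 1 / 2 ≤ ∑ i ∈ Uᶜ, π i →
      ∑ i ∈ U, π i ≤ 4 * (t * flow P π U) := by
    intro U hU
    have hquarter : ∀ i, 1 / 4 ≤ ∑ j ∈ Uᶜ, (P ^ t) i j := fun i => by
      have hsum := (Matrix.sum_row_of_mem_rowStochastic (pow_mem hP t) i).trans hst.1.2.symm
      linarith [sum_sub_sum_le_dTV hsum Uᶜ, dTV_pow_le_of_mixingTime_le hP hst.2 ht i]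
    have hflow : ∑ i ∈ U, π i * (1 / 4) ≤ flow (P ^ t) π U :=
      Finset.sum_le_sum fun i _ => by
        rw [← Finset.mul_sum]
        exact mul_le_mul_of_nonneg_left (hquarter i) (hst.1.1 i)
    rw [← Finset.sum_mul] at hflow
    linarith [flow_pow_le hP hst.1.1 hst.2 U t]
  have htotal : ∑ i ∈ T, π i + ∑ i ∈ Tᶜ, π i = 1 := (Finset.sum_add_sum_compl T π).trans hst.1.2
  rcases le_total (1 / 2) (∑ i ∈ Tᶜ, π i) with h | h
  · exact (min_le_left _ _).trans (escape T h)
  · rw [← flow_compl hP hst.2 T]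
    exact (min_le_right _ _).trans (escape Tᶜ (by rw [compl_compl]; linarith))

theorem flow_le_sum (hP : P ∈ Matrix.rowStochastic ℝ S) (h0 : ∀ i, 0 ≤ π i) (hπ : π ᵥ* P = π)
    {T R : Finset S} (hcross : ∀ i ∈ T, ∀ j ∉ T, P i j ≠ 0 → i ∈ R ∨ j ∈ R) :
    flow P π T ≤ ∑ i ∈ R, π i := by
  have hterm : ∀ i j, 0 ≤ π i * P i j := fun i j =>
    mul_nonneg (h0 i) (Matrix.nonneg_of_mem_rowStochastic hP)
  have hpair : ∀ i ∈ T, ∀ j ∈ Tᶜ, π i * P i j ≤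
      (if i ∈ R then π i * P i j else 0) + if j ∈ R then π i * P i j else 0 := by
    intro i hi j hj
    rcases eq_or_ne (P i j) 0 with hij | hij
    · simp [hij]
    · have := hterm i j
      rcases hcross i hi j (Finset.mem_compl.1 hj) hij with hR | hR <;> rw [if_pos hR] <;>
        split_ifs <;> linarith
  have out_of_R : ∀ i, ∑ j ∈ Tᶜ, (if i ∈ R then π i * P i j else 0) ≤ if i ∈ R then π i else 0 := by
    intro i
    split_ifs
    · calc ∑ j ∈ Tᶜ, π i * P i j ≤ ∑ j, π i * P i j := Finset.sum_le_univ_sum_of_nonneg (hterm i)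
        _ = π i := by rw [← Finset.mul_sum, Matrix.sum_row_of_mem_rowStochastic hP, mul_one]
    · rw [Finset.sum_const_zero]
  have into_R : ∀ j, ∑ i ∈ T, (if j ∈ R then π i * P i j else 0) ≤ if j ∈ R then π j else 0 := by
    intro j
    split_ifs
    · calc ∑ i ∈ T, π i * P i j ≤ ∑ i, π i * P i j :=
            Finset.sum_le_univ_sum_of_nonneg fun i => hterm i j
        _ = π j := congrFun hπ j
    · rw [Finset.sum_const_zero]
  calc flow P π T
      ≤ ∑ i ∈ T, ∑ j ∈ Tᶜ, (if i ∈ R then π i * P i j else 0) +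
          ∑ j ∈ Tᶜ, ∑ i ∈ T, (if j ∈ R then π i * P i j else 0) := by
        rw [Finset.sum_comm (s := Tᶜ), ← Finset.sum_add_distrib]
        refine Finset.sum_le_sum fun i hi => ?_
        rw [← Finset.sum_add_distrib]
        exact Finset.sum_le_sum (hpair i hi)
    _ ≤ ∑ i ∈ T, (if i ∈ R then π i else 0) + ∑ j ∈ Tᶜ, (if j ∈ R then π j else 0) :=
        add_le_add (Finset.sum_le_sum fun i _ => out_of_R i) (Finset.sum_le_sum fun j _ => into_R j)
    _ = ∑ i ∈ R, π i := by rw [Finset.sum_add_sum_compl, Finset.sum_ite_mem, Finset.univ_inter]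

theorem IsStationary.sum_le_of_bisected (hst : IsStationary P π)
    (hP : P ∈ Matrix.rowStochastic ℝ S) {A T R : Finset S}
    (hhalf : ∑ i ∈ A ∩ T, π i = ∑ i ∈ A \ T, π i)
    (hcross : ∀ i ∈ T, ∀ j ∉ T, P i j ≠ 0 → i ∈ R ∨ j ∈ R) {t : ℕ} (ht : mixingTime P π ≤ t) :
    ∑ i ∈ A, π i ≤ 8 * (t * ∑ i ∈ R, π i) := by
  have hA : ∑ i ∈ A ∩ T, π i + ∑ i ∈ A \ T, π i = ∑ i ∈ A, π i :=
    Finset.sum_inter_add_sum_sdiff A T π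
  have hT : (∑ i ∈ A, π i) / 2 ≤ ∑ i ∈ T, π i := by
    have := Finset.sum_le_sum_of_subset_of_nonneg (f := π) (Finset.inter_subset_right : A ∩ T ⊆ T)
      fun i _ _ => hst.1.1 i
    linarith
  have hTc : (∑ i ∈ A, π i) / 2 ≤ ∑ i ∈ Tᶜ, π i := by
    have hsub : A \ T ⊆ Tᶜ := fun i hi => Finset.mem_compl.2 (Finset.mem_sdiff.1 hi).2
    have := Finset.sum_le_sum_of_subset_of_nonneg (f := π) hsub fun i _ _ => hst.1.1 i
    linarith
  have hflow : (t : ℝ) * flow P π T ≤ t * ∑ i ∈ R, π i :=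
    mul_le_mul_of_nonneg_left (flow_le_sum hP hst.1.1 hst.2 hcross) t.cast_nonneg
  linarith [(le_min hT hTc).trans (hst.min_le_flow hP T ht)]

end FiniteChains

/-! ### Matchings and the moves of the Broder chain -/

section Matchings

variable {V : Type*} {G : SimpleGraph V} {M N : Finset (Sym2 V)}

theorem IsMatching.adj (hM : IsMatching G M) {x y : V} (h : s(x, y) ∈ M) : G.Adj x y := hM.1 _ h

theorem IsMatching.right_unique (hM : IsMatching G M) {x y z : V} (h : s(x, y) ∈ M)
    (h' : s(x, z) ∈ M) : y = z :=
  Sym2.congr_right.1 (hM.2 _ h _ h' x (Sym2.mem_mk_left _ _) (Sym2.mem_mk_left _ _))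

theorem IsMatching.subset (hM : IsMatching G M) (h : N ⊆ M) : IsMatching G N :=
  ⟨fun e he => hM.1 e (h he), fun e he f hf => hM.2 e (h he) f (h hf)⟩

theorem IsMatching.filter_not_mem [DecidableEq V] (hM : IsMatching G M) {x y : V}
    (h : s(x, y) ∈ M) : M.filter (fun e => x ∉ e) = M.erase s(x, y) := by
  ext e
  rw [Finset.mem_filter, Finset.mem_erase, and_comm]
  refine and_congr_left fun he => not_congr ⟨fun hx => ?_, ?_⟩
  · exact hM.2 _ he _ h x hx (Sym2.mem_mk_left _ _)
  · rintro rfl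
    exact Sym2.mem_mk_left _ _

variable [Fintype V] [DecidableEq V]

theorem mem_holes {v : V} : v ∈ holes M ↔ ∀ e ∈ M, v ∉ e := by simp [holes]

theorem not_mem_holes {v : V} : v ∉ holes M ↔ ∃ y, s(v, y) ∈ M := by
  rw [mem_holes]
  push Not
  constructor
  · rintro ⟨e, he, y, rfl⟩
    exact ⟨y, he⟩
  · rintro ⟨y, hy⟩
    exact ⟨_, hy, Sym2.mem_mk_left _ _⟩

theorem exists_mem_of_holes_eq_empty (h : holes M = ∅) (v : V) : ∃ y, s(v, y) ∈ M :=
  not_mem_holes.1 (h ▸ Finset.notMem_empty v)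

theorem not_mem_holes_left {x y : V} (h : s(x, y) ∈ M) : x ∉ holes M := not_mem_holes.2 ⟨y, h⟩

theorem not_mem_holes_right {x y : V} (h : s(x, y) ∈ M) : y ∉ holes M :=
  not_mem_holes.2 ⟨x, Sym2.eq_swap ▸ h⟩

theorem IsMatching.insert_edge (hM : IsMatching G M) {p q : V} (hp : p ∈ holes M) (hq : q ∈ holes M)
    (h : G.Adj p q) : IsMatching G (insert s(p, q) M) := by
  have disjoint_edge : ∀ e ∈ M, ∀ v, v ∈ s(p, q) → v ∉ e := by
    intro e he v hv
    rcases Sym2.mem_iff.1 hv with rfl | rfl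
    exacts [mem_holes.1 hp e he, mem_holes.1 hq e he]
  constructor
  · intro e he
    rcases Finset.mem_insert.1 he with rfl | he
    exacts [h, hM.1 e he]
  · intro e he f hf v hve hvf
    rcases Finset.mem_insert.1 he with rfl | he <;> rcases Finset.mem_insert.1 hf with rfl | hf
    exacts [rfl, absurd hvf (disjoint_edge f hf v hve), absurd hve (disjoint_edge e he v hvf),
      hM.2 e he f hf v hve hvf]

theorem holes_insert (p q : V) : holes (insert s(p, q) M) = holes M \ {p, q} := by
  ext v
  simp only [mem_holes, Finset.mem_sdiff, Finset.mem_insert, Finset.mem_singleton,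
    forall_eq_or_imp, Sym2.mem_iff]
  tauto

theorem IsMatching.holes_erase (hM : IsMatching G M) {p q : V} (h : s(p, q) ∈ M) :
    holes (M.erase s(p, q)) = insert p (insert q (holes M)) := by
  ext v
  simp only [mem_holes, Finset.mem_erase, Finset.mem_insert]
  constructor
  · intro hv
    by_cases hpq : v ∈ s(p, q)
    · rcases Sym2.mem_iff.1 hpq with rfl | rfl <;> simp
    · refine Or.inr (Or.inr fun e he hve => hv e ⟨?_, he⟩ hve)
      rintro rfl
      exact hpq hve
  · rintro (rfl | rfl | hv) e ⟨hne, he⟩ hve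
    · exact hne (hM.2 _ he _ h v hve (Sym2.mem_mk_left _ _))
    · exact hne (hM.2 _ he _ h v hve (Sym2.mem_mk_right _ _))
    · exact hv e he hve

theorem IsMatching.holes_erase_ne_empty (hM : IsMatching G M) {e : Sym2 V} (he : e ∈ M) :
    holes (M.erase e) ≠ ∅ := by
  induction e with
  | _ p q => rw [hM.holes_erase he]; exact Finset.insert_ne_empty _ _

/-- `M'` arises from `M` by adding an edge between two holes. -/
def AddStep (G : SimpleGraph V) (M M' : Finset (Sym2 V)) : Prop :=
  ∃ p q, p ∈ holes M ∧ q ∈ holes M ∧ G.Adj p q ∧ M' = insert s(p, q) M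

/-- `M'` arises from `M` by replacing an edge `{x, y}` by `{x, p}`, where `p` is a hole. -/
def SlideStep (G : SimpleGraph V) (M M' : Finset (Sym2 V)) : Prop :=
  ∃ x y p, s(x, y) ∈ M ∧ p ∈ holes M ∧ G.Adj x p ∧ M' = insert s(x, p) (M.erase s(x, y))

section Slide

variable {x y p : V}

theorem IsMatching.slide (hM : IsMatching G M) (hxy : s(x, y) ∈ M) (hp : p ∈ holes M)
    (h : G.Adj x p) : IsMatching G (insert s(x, p) (M.erase s(x, y))) := by
  refine (hM.subset (Finset.erase_subset _ _)).insert_edge ?_ ?_ h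
  · rw [hM.holes_erase hxy]; exact Finset.mem_insert_self _ _
  · rw [hM.holes_erase hxy]; exact Finset.mem_insert_of_mem (Finset.mem_insert_of_mem hp)

theorem IsMatching.holes_slide (hM : IsMatching G M) (hxy : s(x, y) ∈ M) (hp : p ∈ holes M) :
    holes (insert s(x, p) (M.erase s(x, y))) = insert y ((holes M).erase p) := by
  have hx := not_mem_holes_left hxy
  have hyx : y ≠ x := (hM.adj hxy).ne'
  have hyp : y ≠ p := fun h => not_mem_holes_right hxy (h ▸ hp)
  rw [holes_insert, hM.holes_erase hxy]
  ext v
  simp only [Finset.mem_sdiff, Finset.mem_insert, Finset.mem_singleton, Finset.mem_erase]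
  grind

theorem IsMatching.card_holes_slide (hM : IsMatching G M) (hxy : s(x, y) ∈ M) (hp : p ∈ holes M) :
    (holes (insert s(x, p) (M.erase s(x, y)))).card = (holes M).card := by
  rw [hM.holes_slide hxy hp, Finset.card_insert_of_notMem, Finset.card_erase_add_one hp]
  exact fun h => not_mem_holes_right hxy (Finset.mem_of_mem_erase h)

theorem insert_erase_slide (hxy : s(x, y) ∈ M) (hp : p ∈ holes M) :
    insert s(x, y) ((insert s(x, p) (M.erase s(x, y))).erase s(x, p)) = M := by
  rw [Finset.erase_insert, Finset.insert_erase hxy]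
  exact fun h => mem_holes.1 hp _ (Finset.mem_of_mem_erase h) (Sym2.mem_mk_right _ _)

end Slide

theorem SlideStep.symm (hM : IsMatching G M) (h : SlideStep G M N) : SlideStep G N M := by
  obtain ⟨x, y, p, hxy, hp, -, rfl⟩ := h
  refine ⟨x, p, y, Finset.mem_insert_self _ _, ?_, hM.adj hxy, (insert_erase_slide hxy hp).symm⟩
  rw [hM.holes_slide hxy hp]
  exact Finset.mem_insert_self _ _

/-- `M` and `N` differ by a move of the Broder chain, in one direction or the other. -/
def BroderStep (G : SimpleGraph V) (M N : Finset (Sym2 V)) : Prop :=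
  AddStep G M N ∨ AddStep G N M ∨ SlideStep G M N

theorem BroderStep.symm (hM : IsMatching G M) (h : BroderStep G M N) : BroderStep G N M := by
  rcases h with h | h | h
  exacts [Or.inr (Or.inl h), Or.inl h, Or.inr (Or.inr (h.symm hM))]

theorem AddStep.holes_subset (h : AddStep G M N) : holes N ⊆ holes M := by
  obtain ⟨p, q, -, -, -, rfl⟩ := h
  rw [holes_insert]
  exact Finset.sdiff_subset

theorem BroderStep.card_union_holes_le (hM : IsMatching G M) (hMc : (holes M).card ≤ 2)
    (hNc : (holes N).card ≤ 2) (h : BroderStep G M N) : (holes M ∪ holes N).card ≤ 3 := by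
  rcases h with h | h | ⟨x, y, p, hxy, hp, -, rfl⟩
  · rw [Finset.union_eq_left.2 h.holes_subset]
    omega
  · rw [Finset.union_eq_right.2 h.holes_subset]
    omega
  · have hsub : holes M ∪ holes (insert s(x, p) (M.erase s(x, y))) ⊆ insert y (holes M) := by
      rw [hM.holes_slide hxy hp]
      exact Finset.union_subset (Finset.subset_insert _ _)
        (Finset.insert_subset_insert _ (Finset.erase_subset _ _))
    exact (Finset.card_le_card hsub).trans ((Finset.card_insert_le _ _).trans (by omega))

theorem IsMatching.two_mul_card (hM : IsMatching G M) (h : holes M = ∅) :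
    2 * M.card = Fintype.card V := by
  have two_ends : ∀ e ∈ M, (Finset.univ.filter fun v => v ∈ e).card = 2 := by
    intro e he
    induction e with
    | _ x y =>
      have : (Finset.univ.filter fun v => v ∈ s(x, y)) = {x, y} := by ext v; simp
      rw [this, Finset.card_pair (hM.adj he).ne]
  have one_edge : ∀ v ∈ (Finset.univ : Finset V), (M.filter fun e => v ∈ e).card = 1 := by
    intro v _
    obtain ⟨y, hy⟩ := exists_mem_of_holes_eq_empty h v
    refine Finset.card_eq_one.2 ⟨s(v, y), Finset.eq_singleton_iff_unique_mem.2 ⟨?_, ?_⟩⟩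
    · exact Finset.mem_filter.2 ⟨hy, Sym2.mem_mk_left _ _⟩
    · intro e he
      rw [Finset.mem_filter] at he
      exact hM.2 _ he.1 _ hy v he.2 (Sym2.mem_mk_left _ _)
  calc 2 * M.card = ∑ e ∈ M, (Finset.univ.filter fun v => v ∈ e).card := by
        rw [Finset.sum_congr rfl two_ends, Finset.sum_const, smul_eq_mul, mul_comm]
    _ = ∑ v, (M.filter fun e => v ∈ e).card :=
        Finset.sum_card_bipartiteAbove_eq_sum_card_bipartiteBelow fun e v => v ∈ e
    _ = Fintype.card V := by
        rw [Finset.sum_congr rfl one_edge, Finset.sum_const, smul_eq_mul, mul_one, Finset.card_univ]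

theorem IsMatching.card_pos [Nonempty V] (hM : IsMatching G M) (h : holes M = ∅) : 0 < M.card := by
  have := hM.two_mul_card h
  have := Fintype.card_pos (α := V)
  omega

open Classical in
theorem filter_edges_between_pair (p q : V) :
    (Finset.univ.filter fun e => e ∈ G.edgeSet ∧ ∀ z ∈ e, z ∈ ({p, q} : Finset V)) =
      if G.Adj p q then {s(p, q)} else ∅ := by
  ext e
  induction e with
  | _ a b =>
    rw [Finset.mem_filter, apply_ite (s(a, b) ∈ ·)]
    simp only [Finset.mem_univ, true_and, Finset.mem_insert, Finset.mem_singleton, Sym2.mem_iff,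
      SimpleGraph.mem_edgeSet, Sym2.eq_iff, forall_eq_or_imp, forall_eq, Finset.notMem_empty]
    grind [SimpleGraph.Adj.ne, SimpleGraph.Adj.symm]

theorem nearMove_of_mem_adj {p q x : V} (h : holes M = {p, q}) (hpq : G.Adj p q)
    (hx : x ∈ holes M) (w : V) : nearMove G M x w = insert s(p, q) M := by
  rw [nearMove, if_pos hx, h, filter_edges_between_pair, if_pos hpq,
    Finset.insert_eq, Finset.union_comm]

theorem nearMove_of_mem_not_adj {p q x : V} (h : holes M = {p, q}) (hpq : ¬ G.Adj p q)
    (hx : x ∈ holes M) (w : V) : nearMove G M x w = M := by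
  rw [nearMove, if_pos hx, h, filter_edges_between_pair, if_neg hpq,
    Finset.union_empty]

theorem IsMatching.nearMove_of_adj (hM : IsMatching G M) {x y w : V} (hxy : s(x, y) ∈ M)
    (hw : G.Adj x w) : nearMove G M x w = insert s(x, w) (M.erase s(x, y)) := by
  rw [nearMove, if_neg (not_mem_holes_left hxy), if_pos hw, ← hM.filter_not_mem hxy]

theorem IsMatching.nearMove_cases (hM : IsMatching G M) (hc : (holes M).card = 2) (x w : V) :
    nearMove G M x w = M ∨
      (x ∈ holes M ∧ AddStep G M (nearMove G M x w) ∧ holes (nearMove G M x w) = ∅) ∨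
      ∃ y, s(x, y) ∈ M ∧ G.Adj x w ∧ nearMove G M x w = insert s(x, w) (M.erase s(x, y)) := by
  by_cases hx : x ∈ holes M
  · obtain ⟨p, q, -, h⟩ := Finset.card_eq_two.1 hc
    by_cases hpq : G.Adj p q
    · refine Or.inr (Or.inl ⟨hx, ?_, ?_⟩) <;> rw [nearMove_of_mem_adj h hpq hx]
      · exact ⟨p, q, by simp [h], by simp [h], hpq, rfl⟩
      · rw [holes_insert, h, Finset.sdiff_self]
    · exact Or.inl (nearMove_of_mem_not_adj h hpq hx w)
  · by_cases hxw : G.Adj x w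
    · obtain ⟨y, hy⟩ := not_mem_holes.1 hx
      exact Or.inr (Or.inr ⟨y, hy, hxw, hM.nearMove_of_adj hy hxw⟩)
    · exact Or.inl (by rw [nearMove, if_neg hx, if_neg hxw])

theorem IsMatching.nearMove_erase (hM : IsMatching G M) (h : holes M = ∅) {e : Sym2 V}
    (he : e ∈ M) {x : V} (hx : x ∈ holes (M.erase e)) (w : V) :
    nearMove G (M.erase e) x w = M := by
  induction e with
  | _ p q =>
    have hpq : holes (M.erase s(p, q)) = {p, q} := by rw [hM.holes_erase he, h]; rfl
    rw [nearMove_of_mem_adj hpq (hM.adj he) hx, Finset.insert_erase he]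

theorem IsMatching.exists_erase_of_nearMove (hN : IsMatching G N) (hc : (holes N).card = 2)
    {x w : V} (hw : w ∈ holes N) (h : holes (nearMove G N x w) = ∅) :
    x ∈ holes N ∧ ∃ e ∈ nearMove G N x w, N = (nearMove G N x w).erase e := by
  rcases hN.nearMove_cases hc x w with hstay | ⟨hx, ⟨p, q, hp, -, -, hadd⟩, -⟩ | ⟨y, hxy, -, hslide⟩
  · rw [← hstay, h] at hc
    exact absurd hc (by simp)
  · refine ⟨hx, s(p, q), ?_, ?_⟩ <;> rw [hadd]
    · exact Finset.mem_insert_self _ _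
    · exact (Finset.erase_insert fun hpq => not_mem_holes_left hpq hp).symm
  · rw [← hN.card_holes_slide hxy hw, ← hslide, h] at hc
    exact absurd hc (by simp)

end Matchings

section Broder

variable {V : Type*} [Fintype V] [DecidableEq V] {G : SimpleGraph V} {M N P : State G}

theorem State.ext (h : M.1 = N.1) : M = N := Subtype.ext h

theorem State.card_holes_of_ne (h : holes M.1 ≠ ∅) : (holes M.1).card = 2 :=
  M.2.2.resolve_left (mt Finset.card_eq_zero.1 h)

theorem State.card_holes_le_two (M : State G) : (holes M.1).card ≤ 2 := by
  rcases M.2.2 with h | h <;> omega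

/-- The near-perfect matching obtained by removing the edge `e` from a perfect matching. -/
def State.erase (M : State G) (h : holes M.1 = ∅) (e : Sym2 V) (he : e ∈ M.1) : State G :=
  ⟨M.1.erase e, M.2.1.subset (Finset.erase_subset _ _), Or.inr (by
    induction e with
    | _ p q => rw [M.2.1.holes_erase he, h]; exact Finset.card_pair (M.2.1.adj he).ne)⟩

theorem State.coe_erase (M : State G) (h : holes M.1 = ∅) {e : Sym2 V} (he : e ∈ M.1) :
    (M.erase h e he).1 = M.1.erase e := rfl

/-- The matching that `nearMove` leads to from a near-perfect matching, as a state. -/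
def State.near (M : State G) (h : holes M.1 ≠ ∅) (x w : V) (hw : w ∈ holes M.1) : State G :=
  ⟨nearMove G M.1 x w, by
    rcases M.2.1.nearMove_cases (State.card_holes_of_ne h) x w with
      hstay | ⟨-, ⟨p, q, hp, hq, hpq, hadd⟩, hempty⟩ | ⟨y, hxy, hxw, hslide⟩
    · rw [hstay]; exact M.2
    · exact ⟨hadd ▸ M.2.1.insert_edge hp hq hpq, Or.inl (by rw [hempty]; rfl)⟩
    · rw [hslide]
      exact ⟨M.2.1.slide hxy hw hxw, by rw [M.2.1.card_holes_slide hxy hw]; exact M.2.2⟩⟩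

theorem State.coe_near (M : State G) (h : holes M.1 ≠ ∅) (x : V) {w : V} (hw : w ∈ holes M.1) :
    (M.near h x w hw).1 = nearMove G M.1 x w := rfl

theorem broder_nonneg (M N : State G) : 0 ≤ broder G M N := by
  unfold broder; split_ifs <;> positivity

theorem sum_card_filter_val_eq {ι : Type*} {s : Finset ι} {f : ι → Finset (Sym2 V)}
    (hf : ∀ i ∈ s, ∃ N : State G, N.1 = f i) :
    ∑ N : State G, (s.filter fun i => N.1 = f i).card = s.card := by
  let val : State G ↪ Finset (Sym2 V) := ⟨Subtype.val, fun _ _ => State.ext⟩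
  have maps : (s : Set ι).MapsTo f (Finset.univ.map val : Finset (Finset (Sym2 V))) := fun i hi =>
    let ⟨N, hN⟩ := hf i hi
    Finset.mem_map.2 ⟨N, Finset.mem_univ N, hN⟩
  rw [Finset.card_eq_sum_card_fiberwise maps, Finset.sum_map]
  exact Finset.sum_congr rfl fun N _ =>
    congrArg Finset.card (Finset.filter_congr fun _ _ => eq_comm)

theorem sum_broder [Nonempty V] (M : State G) : ∑ N, broder G M N = 1 := by
  unfold broder
  by_cases h : holes M.1 = ∅
  · simp only [if_pos h]
    have hc : (M.1.card : ℝ) ≠ 0 := Nat.cast_ne_zero.2 (M.2.1.card_pos h).ne'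
    rw [← Finset.sum_div, div_eq_one_iff_eq hc, ← Nat.cast_sum, Nat.cast_inj]
    exact sum_card_filter_val_eq fun e he => ⟨M.erase h e he, rfl⟩
  · simp only [if_neg h]
    have hc : ((Fintype.card V : ℝ) * ((holes M.1).card : ℝ)) ≠ 0 := by
      rw [State.card_holes_of_ne h]
      positivity
    rw [← Finset.sum_div, div_eq_one_iff_eq hc, ← Nat.cast_sum, ← Nat.cast_mul, Nat.cast_inj,
      ← Finset.card_univ, ← Finset.card_product]
    exact sum_card_filter_val_eq fun p hp =>
      ⟨M.near h p.1 p.2 (Finset.mem_product.1 hp).2, rfl⟩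

-- A slide of `x` from `y` to the hole `w` is undone by the slide of `x` from `w` to the hole `y`.
theorem card_nearMove_le (hM : holes M.1 ≠ ∅) (hN : holes N.1 ≠ ∅) (hne : M ≠ N) :
    ((Finset.univ ×ˢ holes M.1).filter fun p : V × V => N.1 = nearMove G M.1 p.1 p.2).card ≤
    ((Finset.univ ×ˢ holes N.1).filter fun p : V × V => M.1 = nearMove G N.1 p.1 p.2).card := by
  have slide_of_mem : ∀ p ∈ (Finset.univ ×ˢ holes M.1).filter
      (fun p : V × V => N.1 = nearMove G M.1 p.1 p.2),
      ∃ y, p.2 ∈ holes M.1 ∧ s(p.1, y) ∈ M.1 ∧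
        N.1 = insert s(p.1, p.2) (M.1.erase s(p.1, y)) := by
    intro p hp
    obtain ⟨hw, hp⟩ := Finset.mem_filter.1 hp
    rcases M.2.1.nearMove_cases (State.card_holes_of_ne hM) p.1 p.2 with
      hstay | ⟨-, -, hempty⟩ | ⟨y, hxy, -, hslide⟩
    · exact absurd (State.ext (hstay.symm.trans hp.symm)) hne
    · exact absurd (hp ▸ hempty) hN
    · exact ⟨y, (Finset.mem_product.1 hw).2, hxy, hp.trans hslide⟩
  have : Nonempty V := (Finset.nonempty_iff_ne_empty.2 hM).to_type
  choose! y hw hy hslide using slide_of_mem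
  have new_edge : ∀ p ∈ (Finset.univ ×ˢ holes M.1).filter
      (fun p : V × V => N.1 = nearMove G M.1 p.1 p.2), s(p.1, p.2) ∈ N.1 := fun p hp => by
    rw [hslide p hp]; exact Finset.mem_insert_self _ _
  refine Finset.card_le_card_of_injOn (fun p => (p.1, y p)) ?_ ?_
  · intro p hp
    rw [Finset.mem_coe] at hp
    refine Finset.mem_filter.2 ⟨Finset.mem_product.2 ⟨Finset.mem_univ _, ?_⟩, ?_⟩
    · rw [hslide p hp, M.2.1.holes_slide (hy p hp) (hw p hp)]; exact Finset.mem_insert_self _ _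
    · rw [N.2.1.nearMove_of_adj (new_edge p hp) (M.2.1.adj (hy p hp)), hslide p hp]
      exact (insert_erase_slide (hy p hp) (hw p hp)).symm
  · intro p hp p' hp' h
    obtain ⟨hfst, -⟩ := Prod.mk.inj h
    exact Prod.ext hfst (N.2.1.right_unique (new_edge p hp) (hfst ▸ new_edge p' hp'))

theorem broder_perfect_perfect (hM : holes M.1 = ∅) (hN : holes N.1 = ∅) : broder G M N = 0 := by
  rw [broder, if_pos hM, Finset.filter_eq_empty_iff.2, Finset.card_empty, Nat.cast_zero, zero_div]
  exact fun e he h => M.2.1.holes_erase_ne_empty he (h ▸ hN)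

-- Of the `2 * card V` choices in `N = M.erase e` the four with both vertices in `holes N` add `e`,
-- while `M` has `card V / 2` edges: both transitions have probability `2 / card V`.
theorem broder_perfect_near [Nonempty V] (hM : holes M.1 = ∅) (hN : holes N.1 ≠ ∅) :
    broder G M N = broder G N M := by
  have hcN := State.card_holes_of_ne hN
  have adds_iff : ∀ x, ∀ w ∈ holes N.1, M.1 = nearMove G N.1 x w →
      x ∈ holes N.1 ∧ ∃ e ∈ M.1, N.1 = M.1.erase e := fun x w hw h =>
    h ▸ N.2.1.exists_erase_of_nearMove hcN hw (h ▸ hM)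
  rw [broder, broder, if_pos hM, if_neg hN, hcN, ← M.2.1.two_mul_card hM]
  by_cases h : ∃ e ∈ M.1, N.1 = M.1.erase e
  · obtain ⟨e, he, h⟩ := h
    have edges : (M.1.filter fun e => N.1 = M.1.erase e) = {e} := by
      refine Finset.eq_singleton_iff_unique_mem.2 ⟨Finset.mem_filter.2 ⟨he, h⟩, fun f hf => ?_⟩
      rw [Finset.mem_filter, h] at hf
      exact ((Finset.erase_inj M.1 he).1 hf.2).symm
    have choices : ((Finset.univ ×ˢ holes N.1).filter
        fun p : V × V => M.1 = nearMove G N.1 p.1 p.2) = holes N.1 ×ˢ holes N.1 := by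
      ext ⟨x, w⟩
      simp only [Finset.mem_filter, Finset.mem_product, Finset.mem_univ, true_and]
      refine ⟨fun ⟨hw, hmove⟩ => ⟨(adds_iff x w hw hmove).1, hw⟩, fun ⟨hx, hw⟩ => ⟨hw, ?_⟩⟩
      rw [h] at hx ⊢
      exact (M.2.1.nearMove_erase hM he hx w).symm
    have hc : (M.1.card : ℝ) ≠ 0 := Nat.cast_ne_zero.2 (M.2.1.card_pos hM).ne'
    rw [edges, choices, Finset.card_product, hcN, Finset.card_singleton]
    push_cast
    field_simp
    norm_num
  · have no_edges : (M.1.filter fun e => N.1 = M.1.erase e) = ∅ :=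
      Finset.filter_eq_empty_iff.2 fun e he h' => h ⟨e, he, h'⟩
    have no_choices : ((Finset.univ ×ˢ holes N.1).filter
        fun p : V × V => M.1 = nearMove G N.1 p.1 p.2) = ∅ :=
      Finset.filter_eq_empty_iff.2 fun p hp hmove =>
        h (adds_iff p.1 p.2 (Finset.mem_product.1 hp).2 hmove).2
    simp only [no_edges, no_choices, Finset.card_empty, Nat.cast_zero, zero_div]

theorem broder_symm [Nonempty V] (M N : State G) : broder G M N = broder G N M := by
  by_cases hM : holes M.1 = ∅ <;> by_cases hN : holes N.1 = ∅
  · rw [broder_perfect_perfect hM hN, broder_perfect_perfect hN hM]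
  · exact broder_perfect_near hM hN
  · exact (broder_perfect_near hN hM).symm
  · rcases eq_or_ne M N with rfl | hne
    · rfl
    · rw [broder, broder, if_neg hM, if_neg hN, State.card_holes_of_ne hM,
        State.card_holes_of_ne hN,
        le_antisymm (card_nearMove_le hM hN hne) (card_nearMove_le hN hM hne.symm)]

theorem step_of_broder_ne_zero (hne : M ≠ N) (h : broder G M N ≠ 0) :
    BroderStep G M.1 N.1 := by
  unfold broder at h
  split_ifs at h with hM
  · obtain ⟨e, he⟩ := Finset.card_ne_zero.1 (Nat.cast_ne_zero.1 (div_ne_zero_iff.1 h).1)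
    obtain ⟨he, hN⟩ := Finset.mem_filter.1 he
    induction e with
    | _ p q =>
      refine Or.inr (Or.inl ⟨p, q, ?_, ?_, M.2.1.adj he, by rw [hN, Finset.insert_erase he]⟩) <;>
      · rw [hN, M.2.1.holes_erase he]; simp
  · obtain ⟨⟨x, w⟩, hp⟩ := Finset.card_ne_zero.1 (Nat.cast_ne_zero.1 (div_ne_zero_iff.1 h).1)
    obtain ⟨hp, hN⟩ := Finset.mem_filter.1 hp
    rcases M.2.1.nearMove_cases (State.card_holes_of_ne hM) x w with
      hstay | ⟨-, hadd, -⟩ | ⟨y, hxy, hxw, hslide⟩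
    · exact absurd (State.ext (hstay.symm.trans hN.symm)) hne
    · exact Or.inl (hN ▸ hadd)
    · exact Or.inr (Or.inr ⟨x, y, w, hxy, (Finset.mem_product.1 hp).2, hxw, hN.trans hslide⟩)

theorem broder_near_pos (hM : holes M.1 ≠ ∅) (x : V) {w : V} (hw : w ∈ holes M.1) :
    0 < broder G M (M.near hM x w hw) := by
  rw [broder, if_neg hM, State.card_holes_of_ne hM]
  have : 0 < ((Finset.univ ×ˢ holes M.1).filter
        fun p : V × V => (M.near hM x w hw).1 = nearMove G M.1 p.1 p.2).card :=
    Finset.card_pos.2 ⟨(x, w), Finset.mem_filter.2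
      ⟨Finset.mem_product.2 ⟨Finset.mem_univ _, hw⟩, rfl⟩⟩
  have : Nonempty V := ⟨x⟩
  positivity

theorem broder_erase_pos (hM : holes M.1 = ∅) {e : Sym2 V} (he : e ∈ M.1) :
    0 < broder G M (M.erase hM e he) := by
  rw [broder, if_pos hM]
  have : 0 < (M.1.filter fun f => (M.erase hM e he).1 = M.1.erase f).card :=
    Finset.card_pos.2 ⟨e, Finset.mem_filter.2 ⟨he, rfl⟩⟩
  have : 0 < M.1.card := Finset.card_pos.2 ⟨e, he⟩
  positivity

/-- A measure of how close `M` is to the perfect matching `P`, used to show that `P` can be reached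
from `M`. Each shared edge counts twice, so that sharing one more edge outweighs the loss of the
bonus that near-perfect matchings receive for being ready to slide. -/
def progress (P M : State G) : ℕ :=
  2 * (M.1 ∩ P.1).card + if holes M.1 = ∅ then 0 else 1

theorem progress_le (P M : State G) : progress P M ≤ 2 * P.1.card + 1 := by
  have := Finset.card_le_card (Finset.inter_subset_right : M.1 ∩ P.1 ⊆ P.1)
  unfold progress; split_ifs <;> omega

theorem progress_lt_of_inter_eq_insert (hM : holes M.1 ≠ ∅) {e : Sym2 V} (he : e ∉ M.1)
    (h : N.1 ∩ P.1 = insert e (M.1 ∩ P.1)) : progress P M < progress P N := by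
  unfold progress
  rw [h, Finset.card_insert_of_notMem fun h => he (Finset.mem_inter.1 h).1, if_neg hM]
  omega

theorem exists_progress_of_perfect (hP : holes P.1 = ∅) (hM : holes M.1 = ∅) (hne : M ≠ P) :
    ∃ N, 0 < broder G M N ∧ progress P M < progress P N := by
  obtain ⟨e, he, heP⟩ : ∃ e ∈ M.1, e ∉ P.1 := by
    refine Finset.not_subset.1 fun hsub => hne (State.ext (Finset.eq_of_subset_of_card_le hsub ?_))
    have := M.2.1.two_mul_card hM
    have := P.2.1.two_mul_card hP
    omega
  refine ⟨M.erase hM e he, broder_erase_pos hM he, ?_⟩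
  have hinter : (M.erase hM e he).1 ∩ P.1 = M.1 ∩ P.1 := by
    rw [M.coe_erase, Finset.erase_inter, Finset.erase_eq_of_notMem]
    exact fun h => heP (Finset.mem_inter.1 h).2
  rw [progress, progress, if_pos hM, hinter, M.coe_erase,
    if_neg (M.2.1.holes_erase_ne_empty he)]
  omega

-- The edge of `P` at a hole `p` of `M` is brought into `M`, by adding it if its other end `x` is a
-- hole too, and by sliding the edge of `M` at `x` otherwise.
theorem exists_progress_of_near (hP : holes P.1 = ∅) (hM : holes M.1 ≠ ∅) :
    ∃ N, 0 < broder G M N ∧ progress P M < progress P N := by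
  obtain ⟨p, q, -, hpq⟩ := Finset.card_eq_two.1 (State.card_holes_of_ne hM)
  have hp : p ∈ holes M.1 := by rw [hpq]; exact Finset.mem_insert_self _ _
  obtain ⟨x, hpx⟩ := exists_mem_of_holes_eq_empty hP p
  have hxp : s(x, p) ∈ P.1 := Sym2.eq_swap ▸ hpx
  have hnew : s(x, p) ∉ M.1 := fun h => not_mem_holes_right h hp
  refine ⟨M.near hM x p hp, broder_near_pos hM x hp, progress_lt_of_inter_eq_insert hM hnew ?_⟩
  by_cases hx : x ∈ holes M.1
  · have hxq : x = q := by
      rw [hpq, Finset.mem_insert, Finset.mem_singleton] at hx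
      exact hx.resolve_left (P.2.1.adj hxp).ne
    subst hxq
    rw [M.coe_near, nearMove_of_mem_adj hpq (P.2.1.adj hpx) hx, Sym2.eq_swap,
      Finset.insert_inter_of_mem hxp]
  · obtain ⟨y, hxy⟩ := not_mem_holes.1 hx
    have hxyP : s(x, y) ∉ P.1 := fun h =>
      not_mem_holes_right hxy (P.2.1.right_unique h hxp ▸ hp)
    rw [M.coe_near, M.2.1.nearMove_of_adj hxy (P.2.1.adj hxp), Finset.insert_inter_of_mem hxp,
      Finset.erase_inter, Finset.erase_eq_of_notMem]
    exact fun h => hxyP (Finset.mem_inter.1 h).2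

theorem broder_reaches_perfect (hP : holes P.1 = ∅) (M : State G) :
    Relation.ReflTransGen (fun M N : State G => 0 < broder G M N) M P := by
  induction h : 2 * P.1.card + 1 - progress P M using Nat.strong_induction_on generalizing M with
  | _ n ih =>
    rcases eq_or_ne M P with rfl | hne
    · exact .refl
    · obtain ⟨N, hpos, hlt⟩ : ∃ N, 0 < broder G M N ∧ progress P M < progress P N := by
        by_cases hM : holes M.1 = ∅
        exacts [exists_progress_of_perfect hP hM hne, exists_progress_of_near hP hM]
      have := progress_le P N
      exact .head hpos (ih _ (by omega) N rfl)

theorem broder_irreducible [Nonempty V] (hP : holes P.1 = ∅) :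
    IsIrreducibleChain (S := State G) (broder G) := fun M N => by
  have reversible : Std.Symm fun M N : State G => 0 < broder G M N :=
    ⟨fun A B h => by rwa [broder_symm]⟩
  exact (broder_reaches_perfect hP M).trans
    (Relation.ReflTransGen.stdSymm.symm _ _ (broder_reaches_perfect hP N))

end Broder

section Metropolis

variable {V : Type*} [Fintype V] [DecidableEq V] {G : SimpleGraph V} {w : State G → ℝ}
  {M N P : State G}

theorem broder_mul_min_le_metropolis (M N : State G) :
    broder G M N * min 1 (w N / w M) ≤ metropolis G w M N := by
  refine le_add_of_nonneg_right ?_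
  split_ifs
  · exact Finset.sum_nonneg fun K _ => mul_nonneg (broder_nonneg _ _)
      (sub_nonneg.2 (min_le_left _ _))
  · exact le_rfl

theorem metropolis_of_ne (h : M ≠ N) :
    metropolis G w M N = broder G M N * min 1 (w N / w M) := by
  rw [metropolis, if_neg h, add_zero]

theorem metropolis_mem_rowStochastic [Nonempty V] (hw : ∀ M, 0 < w M) :
    metropolis G w ∈ Matrix.rowStochastic ℝ (State G) := by
  refine Matrix.mem_rowStochastic_iff_sum.2 ⟨fun M N => ?_, fun M => ?_⟩
  · have hmin : 0 ≤ min 1 (w N / w M) := le_min zero_le_one (div_nonneg (hw N).le (hw M).le)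
    exact (mul_nonneg (broder_nonneg M N) hmin).trans (broder_mul_min_le_metropolis M N)
  · unfold metropolis
    rw [Finset.sum_add_distrib, Finset.sum_ite_eq, if_pos (Finset.mem_univ _),
      ← Finset.sum_add_distrib]
    exact (Finset.sum_congr rfl fun N _ => by ring).trans (sum_broder M)

theorem metropolis_detailedBalance [Nonempty V] (hw : ∀ M, 0 < w M) :
    DetailedBalance (metropolis G w) w := by
  intro M N
  rcases eq_or_ne M N with rfl | h
  · rfl
  · have hmin : ∀ A B : State G, w A * min 1 (w B / w A) = min (w A) (w B) := fun A B => by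
      rw [mul_min_of_nonneg _ _ (hw A).le, mul_one, mul_div_cancel₀ _ (hw A).ne']
    rw [metropolis_of_ne h, metropolis_of_ne h.symm, broder_symm N M, mul_left_comm, hmin,
      mul_left_comm, hmin, min_comm]

theorem metropolis_irreducible [Nonempty V] (hw : ∀ M, 0 < w M) (hP : holes P.1 = ∅) :
    IsIrreducibleChain (metropolis G w) := fun M N =>
  Relation.ReflTransGen.mono
    (fun A B h => (mul_pos h (lt_min one_pos (div_pos (hw B) (hw A)))).trans_le
      (broder_mul_min_le_metropolis A B)) M N (broder_irreducible hP M N)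

theorem step_of_metropolis_ne_zero (hne : M ≠ N) (h : metropolis G w M N ≠ 0) :
    BroderStep G M.1 N.1 := by
  rw [metropolis_of_ne hne] at h
  exact step_of_broder_ne_zero hne (left_ne_zero_of_mul h)

theorem metropolis_isStationary [Nonempty V] [Nonempty (State G)] (hw : ∀ M, 0 < w M) :
    IsStationary (metropolis G w) fun M => w M / ∑ N, w N := by
  have hZ : 0 < ∑ N, w N := Finset.sum_pos (fun N _ => hw N) Finset.univ_nonempty
  refine ⟨⟨fun M => (div_pos (hw M) hZ).le, ?_⟩,
    DetailedBalance.vecMul (metropolis_mem_rowStochastic hw) fun M N => ?_⟩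
  · rw [← Finset.sum_div, div_self hZ.ne']
  · rw [div_mul_eq_mul_div, div_mul_eq_mul_div, metropolis_detailedBalance hw]

theorem metropolis_eq_of_isStationary [Nonempty V] (hw : ∀ M, 0 < w M) (hP : holes P.1 = ∅)
    {π : State G → ℝ} (hπ : IsStationary (metropolis G w) π) : π = fun M => w M / ∑ N, w N := by
  have : Nonempty (State G) := ⟨P⟩
  have hZ : 0 < ∑ N, w N := Finset.sum_pos (fun N _ => hw N) Finset.univ_nonempty
  refine (metropolis_irreducible hw hP).eq_of_isStationary (metropolis_mem_rowStochastic hw)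
    (fun M N => ?_) (fun M => div_pos (hw M) hZ) (metropolis_isStationary hw).1.2 hπ
  rw [div_mul_eq_mul_div, div_mul_eq_mul_div, metropolis_detailedBalance hw]

end Metropolis

/-! ### Adjacency in the graphs -/

section Adjacency

variable {k : ℕ}

/-- Adjacency of positions on the twelve-cycle of the gadget with the chord `{a, b}`. -/
def CycAdj (m m' : Fin 12) : Prop :=
  m' = m + 1 ∨ m = m' + 1 ∨ (m = 0 ∧ m' = 6) ∨ (m = 6 ∧ m' = 0)

instance : DecidableRel CycAdj := fun _ _ => inferInstanceAs (Decidable (_ ∨ _))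

/-- The end of the `c`-th chain of boxes on the chord: `a`, `a`, `b`, `b`. -/
def hub : Fin 4 → Fin 12 := ![0, 0, 6, 6]

/-- The other end of the `c`-th chain of boxes: `w₁`, `z₁`, `w₂`, `z₂`. -/
def tip : Fin 4 → Fin 12 := ![2, 10, 4, 8]

/-- The common neighbour of `hub c` and `tip c`: `x₁`, `y₁`, `x₂`, `y₂`. -/
def mid : Fin 4 → Fin 12 := ![1, 11, 5, 7]

/-- The vertex `u` or `v` adjacent to `tip c`. -/
def pole : Fin 4 → Fin 12 := ![3, 9, 3, 9]

/-- The other chain of boxes with the same hub. -/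
def twin : Fin 4 → Fin 4 := ![1, 0, 3, 2]

theorem BoxVertex.isEnd_v {i : Fin (2 * k)} :
    (BoxVertex.v i).IsEnd ↔ (i : ℕ) = 0 ∨ (i : ℕ) + 1 = 2 * k := Iff.rfl

theorem BoxVertex.not_isEnd_a {i : Fin k} : ¬ (BoxVertex.a i).IsEnd := fun h => h

theorem BoxVertex.not_isEnd_b {i : Fin k} : ¬ (BoxVertex.b i).IsEnd := fun h => h

theorem BoxVertex.IsEnd.exists_eq_v {p : BoxVertex k} (h : p.IsEnd) : ∃ i, p = .v i := by
  rcases p with i | i | i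
  exacts [⟨i, rfl⟩, h.elim, h.elim]

theorem chainMap_of_not_isEnd (c : Fin 4) {p : BoxVertex k} (h : ¬ p.IsEnd) :
    chainMap k c p = .inner c ⟨p, h⟩ := by
  rw [chainMap, dif_neg h]

theorem chainMap_start (c : Fin 4) {i : Fin (2 * k)} (h : (i : ℕ) = 0) :
    chainMap k c (.v i) = .cyc (chainStart c) := by
  rw [chainMap, dif_pos (BoxVertex.isEnd_v.2 (Or.inl h)), if_pos ⟨i, rfl, h⟩]

theorem chainMap_end (c : Fin 4) {i : Fin (2 * k)} (h : (i : ℕ) + 1 = 2 * k) :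
    chainMap k c (.v i) = .cyc (chainEnd c) := by
  rw [chainMap, dif_pos (BoxVertex.isEnd_v.2 (Or.inr h)), if_neg]
  rintro ⟨j, hj, hj0⟩
  obtain rfl := BoxVertex.v.inj hj
  omega

theorem chainMap_of_isEnd (c : Fin 4) {p : BoxVertex k} (h : p.IsEnd) :
    chainMap k c p = .cyc (hub c) ∨ chainMap k c p = .cyc (tip c) := by
  rcases p with i | i | i
  · rcases h with h | h
    · rw [chainMap_start c h]; fin_cases c <;> simp [chainStart, hub, tip]
    · rw [chainMap_end c h]; fin_cases c <;> simp [chainEnd, hub, tip]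
  · exact h.elim
  · exact h.elim

theorem isEnd_of_chainMap_eq_cyc {c : Fin 4} {p : BoxVertex k} {m : Fin 12}
    (h : chainMap k c p = .cyc m) : p.IsEnd := by
  by_contra hp
  rw [chainMap_of_not_isEnd c hp] at h
  cases h

theorem chainMap_eq_inner {c c' : Fin 4} {p : BoxVertex k} {q : {p : BoxVertex k // ¬ p.IsEnd}}
    (h : chainMap k c p = .inner c' q) : c = c' ∧ p = q := by
  by_cases hp : p.IsEnd
  · rcases chainMap_of_isEnd c hp with h' | h' <;> rw [h'] at h <;> cases h
  · rw [chainMap_of_not_isEnd c hp] at h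
    cases h
    exact ⟨rfl, rfl⟩

theorem chainMap_injective (c : Fin 4) : Function.Injective (chainMap k c) := by
  have start_ne_end : chainStart c ≠ chainEnd c := by revert c; decide
  intro p q h
  by_cases hq : q.IsEnd
  · have hp : p.IsEnd := by
      rcases chainMap_of_isEnd c hq with h' | h' <;> exact isEnd_of_chainMap_eq_cyc (h.trans h')
    obtain ⟨i, rfl⟩ := BoxVertex.IsEnd.exists_eq_v hp
    obtain ⟨j, rfl⟩ := BoxVertex.IsEnd.exists_eq_v hq
    rcases hp with hi | hi <;> rcases hq with hj | hj
    · congr 1; ext; omega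
    · rw [chainMap_start c hi, chainMap_end c hj] at h
      exact absurd (GadgetVertex.cyc.inj h) start_ne_end
    · rw [chainMap_end c hi, chainMap_start c hj] at h
      exact absurd (GadgetVertex.cyc.inj h).symm start_ne_end
    · congr 1; ext; omega
  · exact (chainMap_eq_inner (h.trans (chainMap_of_not_isEnd c hq))).2

/-- The oriented edges of the chain of boxes, that is, the relation whose symmetrization defines
`boxChain`. -/
def BoxRel (p q : BoxVertex k) : Prop :=
  match p, q with
    | .v i, .v j => (i : ℕ) + 1 = j
    | .v i, .a j => (i : ℕ) = 2 * j
    | .a i, .b j => i = j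
    | .b i, .v j => (j : ℕ) = 2 * i + 1
    | _, _ => False

theorem boxRel_irrefl (p : BoxVertex k) : ¬ BoxRel p p := by
  rcases p with _ | _ | _ <;> simp [BoxRel]

theorem boxChain_adj {p q : BoxVertex k} :
    (boxChain k).Adj p q ↔ BoxRel p q ∨ BoxRel q p := by
  have h : (boxChain k).Adj p q ↔ p ≠ q ∧ (BoxRel p q ∨ BoxRel q p) := by
    rw [boxChain, SimpleGraph.fromRel_adj]; rfl
  rw [h, and_iff_right_iff_imp]
  rintro h' rfl
  exact (boxRel_irrefl p) (h'.elim id id)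

theorem CycAdj.symm {m m' : Fin 12} (h : CycAdj m m') : CycAdj m' m := by
  unfold CycAdj at *; tauto

theorem CycAdj.ne {m m' : Fin 12} (h : CycAdj m m') : m ≠ m' := by
  revert m m'; decide

theorem cycAdj_iff {m m' : Fin 12} :
    CycAdj m m' ↔ (SimpleGraph.cycleGraph 12).Adj m m' ∨ (m = 0 ∧ m' = 6) ∨ (m = 6 ∧ m' = 0) := by
  rw [SimpleGraph.cycleGraph_adj]
  revert m m'; decide

theorem gadget_adj_of_boxChain_adj (c : Fin 4) {p q : BoxVertex k} (h : (boxChain k).Adj p q) :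
    (gadget k).Adj (chainMap k c p) (chainMap k c q) := by
  rw [gadget, SimpleGraph.fromRel_adj]
  exact ⟨fun h' => h.ne (chainMap_injective c h'), Or.inl (Or.inr (Or.inr ⟨c, p, q, h, rfl, rfl⟩))⟩

theorem gadget_adj_of_cycAdj {m m' : Fin 12} (h : CycAdj m m') :
    (gadget k).Adj (.cyc m) (.cyc m') := by
  rw [gadget, SimpleGraph.fromRel_adj]
  refine ⟨fun h' => h.ne (GadgetVertex.cyc.inj h'), ?_⟩
  rcases cycAdj_iff.1 h with h | ⟨rfl, rfl⟩ | ⟨rfl, rfl⟩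
  · exact Or.inl (Or.inl ⟨m, m', h, rfl, rfl⟩)
  · exact Or.inl (Or.inr (Or.inl ⟨rfl, rfl⟩))
  · exact Or.inr (Or.inr (Or.inl ⟨rfl, rfl⟩))

theorem gadget_adj_iff {r s : GadgetVertex k} : (gadget k).Adj r s ↔
    (∃ m m', CycAdj m m' ∧ r = .cyc m ∧ s = .cyc m') ∨
    ∃ c p q, (boxChain k).Adj p q ∧ r = chainMap k c p ∧ s = chainMap k c q := by
  constructor
  · rw [gadget, SimpleGraph.fromRel_adj]
    rintro ⟨-, (⟨m, m', h, rfl, rfl⟩ | ⟨rfl, rfl⟩ | h) | (⟨m, m', h, rfl, rfl⟩ | ⟨rfl, rfl⟩ | h)⟩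
    · exact Or.inl ⟨m, m', cycAdj_iff.2 (Or.inl h), rfl, rfl⟩
    · exact Or.inl ⟨0, 6, by decide, rfl, rfl⟩
    · exact Or.inr h
    · exact Or.inl ⟨m', m, CycAdj.symm (cycAdj_iff.2 (Or.inl h)), rfl, rfl⟩
    · exact Or.inl ⟨6, 0, by decide, rfl, rfl⟩
    · obtain ⟨c, p, q, h, rfl, rfl⟩ := h
      exact Or.inr ⟨c, q, p, h.symm, rfl, rfl⟩
  · rintro (⟨m, m', h, rfl, rfl⟩ | ⟨c, p, q, h, rfl, rfl⟩)
    · exact gadget_adj_of_cycAdj h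
    · exact gadget_adj_of_boxChain_adj c h

theorem gadget_adj_inner {c : Fin 4} {p : {p : BoxVertex k // ¬ p.IsEnd}} {r : GadgetVertex k} :
    (gadget k).Adj (.inner c p) r ↔ ∃ q, (boxChain k).Adj p.1 q ∧ r = chainMap k c q := by
  constructor
  · rw [gadget_adj_iff]
    rintro (⟨m, m', -, h, -⟩ | ⟨c', p', q, h, h1, rfl⟩)
    · cases h
    · obtain ⟨rfl, rfl⟩ := chainMap_eq_inner h1.symm
      exact ⟨q, h, rfl⟩
  · rintro ⟨q, h, rfl⟩
    rw [← chainMap_of_not_isEnd c p.2]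
    exact gadget_adj_of_boxChain_adj c h

theorem boxChain_not_adj_of_isEnd (hk : 2 ≤ k) {p q : BoxVertex k} (hp : p.IsEnd) (hq : q.IsEnd) :
    ¬ (boxChain k).Adj p q := by
  obtain ⟨i, rfl⟩ := hp.exists_eq_v
  obtain ⟨j, rfl⟩ := hq.exists_eq_v
  rw [BoxVertex.isEnd_v] at hp hq
  rw [boxChain_adj, BoxRel, BoxRel]
  omega

theorem gadget_adj_cyc_cases (hk : 2 ≤ k) {m : Fin 12} {r : GadgetVertex k}
    (h : (gadget k).Adj (.cyc m) r) : (∃ m', CycAdj m m' ∧ r = .cyc m') ∨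
      ∃ c p, r = .inner c p ∧ (m = hub c ∨ m = tip c) := by
  rcases r with m' | ⟨c, p⟩
  · rcases gadget_adj_iff.1 h with ⟨m₁, m₂, hm, h₁, h₂⟩ | ⟨c, p, q, hpq, hp, hq⟩
    · cases h₁; cases h₂
      exact Or.inl ⟨m', hm, rfl⟩
    · exact absurd hpq (boxChain_not_adj_of_isEnd hk (isEnd_of_chainMap_eq_cyc hp.symm)
        (isEnd_of_chainMap_eq_cyc hq.symm))
  · obtain ⟨q, -, hq⟩ := gadget_adj_inner.1 h.symm
    refine Or.inr ⟨c, p, rfl, ?_⟩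
    rcases chainMap_of_isEnd c (isEnd_of_chainMap_eq_cyc hq.symm) with h' | h' <;>
      rw [h'] at hq <;> cases hq <;> simp

@[simp]
theorem adj_copy_copy {i j : Fin 4} {r s : GadgetVertex k} :
    (counterexampleGraph k).Adj (.copy i r) (.copy j s) ↔ i = j ∧ (gadget k).Adj r s := by
  rw [counterexampleGraph, SimpleGraph.fromRel_adj]
  constructor
  · rintro ⟨-, h | h⟩
    exacts [h, ⟨h.1.symm, h.2.symm⟩]
  · intro h
    exact ⟨fun h' => h.2.ne (GVertex.copy.inj h').2, Or.inl h⟩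

@[simp]
theorem adj_t_copy {i j : Fin 4} {r : GadgetVertex k} :
    (counterexampleGraph k).Adj (.t i) (.copy j r) ↔
      (r = .cyc 3 ∧ j = i) ∨ (r = .cyc 9 ∧ j = i - 1) := by
  rw [counterexampleGraph, SimpleGraph.fromRel_adj]
  constructor
  · rintro ⟨-, h | h⟩
    exacts [h, h.elim]
  · intro h
    exact ⟨by simp, Or.inl h⟩

@[simp]
theorem not_adj_t_t {i j : Fin 4} : ¬ (counterexampleGraph k).Adj (.t i) (.t j) := by
  rw [counterexampleGraph, SimpleGraph.fromRel_adj]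
  rintro ⟨-, h | h⟩ <;> exact h

/-- The vertex of the `j`-th copy of the gadget at position `m` of the twelve-cycle. -/
abbrev cy (j : Fin 4) (m : Fin 12) : GVertex k := .copy j (.cyc m)

/-- The inner vertex `p` of the `c`-th chain of boxes in the `j`-th copy of the gadget. -/
abbrev inn (j c : Fin 4) (p : {p : BoxVertex k // ¬ p.IsEnd}) : GVertex k := .copy j (.inner c p)

theorem adj_t_cases {i : Fin 4} {y : GVertex k} (h : (counterexampleGraph k).Adj (.t i) y) :
    y = cy i 3 ∨ y = cy (i - 1) 9 := by
  rcases y with j | ⟨j, r⟩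
  · exact absurd h not_adj_t_t
  · rcases adj_t_copy.1 h with ⟨rfl, rfl⟩ | ⟨rfl, rfl⟩ <;> simp

theorem adj_copy_t_cases {j i : Fin 4} {r : GadgetVertex k}
    (h : (counterexampleGraph k).Adj (.copy j r) (.t i)) :
    (r = .cyc 3 ∧ i = j) ∨ (r = .cyc 9 ∧ i = j + 1) := by
  rcases adj_t_copy.1 h.symm with ⟨rfl, rfl⟩ | ⟨rfl, rfl⟩ <;> simp

theorem adj_copy_cases {j : Fin 4} {r : GadgetVertex k} {y : GVertex k}
    (h : (counterexampleGraph k).Adj (.copy j r) y) :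
    (∃ s, y = .copy j s ∧ (gadget k).Adj r s) ∨
      (r = .cyc 3 ∧ y = .t j) ∨ (r = .cyc 9 ∧ y = .t (j + 1)) := by
  rcases y with i | ⟨i, s⟩
  · rcases adj_copy_t_cases h with ⟨rfl, rfl⟩ | ⟨rfl, rfl⟩ <;> simp
  · obtain ⟨rfl, h'⟩ := adj_copy_copy.1 h
    exact Or.inl ⟨s, rfl, h'⟩

theorem adj_cy_cases (hk : 2 ≤ k) {j : Fin 4} {m : Fin 12} {y : GVertex k}
    (h : (counterexampleGraph k).Adj (cy j m) y) :
    (∃ m', CycAdj m m' ∧ y = cy j m') ∨ (∃ c p, y = inn j c p ∧ (m = hub c ∨ m = tip c)) ∨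
      (m = 3 ∧ y = .t j) ∨ (m = 9 ∧ y = .t (j + 1)) := by
  rcases adj_copy_cases h with ⟨s, rfl, hs⟩ | ⟨hm, rfl⟩ | ⟨hm, rfl⟩
  · rcases gadget_adj_cyc_cases hk hs with ⟨m', h1, rfl⟩ | ⟨c, p, rfl, h1⟩
    · exact Or.inl ⟨m', h1, rfl⟩
    · exact Or.inr (Or.inl ⟨c, p, rfl, h1⟩)
  · cases hm; simp
  · cases hm; simp

theorem adj_mid_cases (hk : 2 ≤ k) {j c : Fin 4} {y : GVertex k}
    (h : (counterexampleGraph k).Adj (cy j (mid c)) y) : y = cy j (hub c) ∨ y = cy j (tip c) := by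
  have on_cycle : ∀ c m, CycAdj (mid c) m → m = hub c ∨ m = tip c := by decide
  have not_end : ∀ c c', ¬ (mid c = hub c' ∨ mid c = tip c') := by decide
  have not_pole : ∀ c, mid c ≠ 3 ∧ mid c ≠ 9 := by decide
  rcases adj_cy_cases hk h with ⟨m, hm, rfl⟩ | ⟨c', p, rfl, hc'⟩ | ⟨hc, -⟩ | ⟨hc, -⟩
  · rcases on_cycle c m hm with rfl | rfl <;> simp
  · exact absurd hc' (not_end c c')
  · exact absurd hc (not_pole c).1
  · exact absurd hc (not_pole c).2

theorem adj_tip_cases (hk : 2 ≤ k) {j c : Fin 4} {y : GVertex k}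
    (h : (counterexampleGraph k).Adj (cy j (tip c)) y) :
    y = cy j (mid c) ∨ y = cy j (pole c) ∨ ∃ p, y = inn j c p := by
  have on_cycle : ∀ c m, CycAdj (tip c) m → m = mid c ∨ m = pole c := by decide
  have tip_of : ∀ c c', tip c = hub c' ∨ tip c = tip c' → c' = c := by decide
  have not_pole : ∀ c, tip c ≠ 3 ∧ tip c ≠ 9 := by decide
  rcases adj_cy_cases hk h with ⟨m, hm, rfl⟩ | ⟨c', p, rfl, hc'⟩ | ⟨hc, -⟩ | ⟨hc, -⟩
  · rcases on_cycle c m hm with rfl | rfl <;> simp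
  · obtain rfl := tip_of c c' hc'
    exact Or.inr (Or.inr ⟨p, rfl⟩)
  · exact absurd hc (not_pole c).1
  · exact absurd hc (not_pole c).2

theorem adj_hub_cases (hk : 2 ≤ k) {j c : Fin 4} {y : GVertex k}
    (h : (counterexampleGraph k).Adj (cy j (hub c)) y) :
    y = cy j (mid c) ∨ y = cy j (mid (twin c)) ∨ y = cy j (hub (c + 2)) ∨
      (∃ p, y = inn j c p) ∨ ∃ p, y = inn j (twin c) p := by
  have on_cycle : ∀ c m, CycAdj (hub c) m → m = mid c ∨ m = mid (twin c) ∨ m = hub (c + 2) := by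
    decide
  have hub_of : ∀ c c', hub c = hub c' ∨ hub c = tip c' → c' = c ∨ c' = twin c := by decide
  have not_pole : ∀ c, hub c ≠ 3 ∧ hub c ≠ 9 := by decide
  rcases adj_cy_cases hk h with ⟨m, hm, rfl⟩ | ⟨c', p, rfl, hc'⟩ | ⟨hc, -⟩ | ⟨hc, -⟩
  · rcases on_cycle c m hm with rfl | rfl | rfl <;> simp
  · rcases hub_of c c' hc' with rfl | rfl <;> simp
  · exact absurd hc (not_pole c).1
  · exact absurd hc (not_pole c).2

theorem adj_pole_cases (hk : 2 ≤ k) {j c : Fin 4} {y : GVertex k}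
    (h : (counterexampleGraph k).Adj (cy j (pole c)) y) :
    y = cy j (tip c) ∨ y = cy j (tip (c + 2)) ∨ ∃ i, y = .t i := by
  have on_cycle : ∀ c m, CycAdj (pole c) m → m = tip c ∨ m = tip (c + 2) := by decide
  have not_end : ∀ c c', ¬ (pole c = hub c' ∨ pole c = tip c') := by decide
  rcases adj_cy_cases hk h with ⟨m, hm, rfl⟩ | ⟨c', p, rfl, hc'⟩ | ⟨-, rfl⟩ | ⟨-, rfl⟩
  · rcases on_cycle c m hm with rfl | rfl <;> simp
  · exact absurd hc' (not_end c c')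
  · simp
  · simp

theorem exists_boxChain_adj_of_adj_inn {j c : Fin 4} {p : {p : BoxVertex k // ¬ p.IsEnd}}
    {y : GVertex k} (h : (counterexampleGraph k).Adj (inn j c p) y) :
    ∃ q, (boxChain k).Adj p.1 q ∧ y = .copy j (chainMap k c q) := by
  rcases adj_copy_cases h with ⟨s, rfl, hs⟩ | ⟨hm, rfl⟩ | ⟨hm, rfl⟩
  · obtain ⟨q, hq, rfl⟩ := gadget_adj_inner.1 hs
    exact ⟨q, hq, rfl⟩
  · cases hm
  · cases hm

theorem adj_inn_cases {j c : Fin 4} {p : {p : BoxVertex k // ¬ p.IsEnd}} {y : GVertex k}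
    (h : (counterexampleGraph k).Adj (inn j c p) y) :
    (∃ q, y = inn j c q) ∨ y = cy j (hub c) ∨ y = cy j (tip c) := by
  obtain ⟨q, -, rfl⟩ := exists_boxChain_adj_of_adj_inn h
  by_cases hq : q.IsEnd
  · rcases chainMap_of_isEnd c hq with h' | h' <;> rw [h'] <;> simp
  · rw [chainMap_of_not_isEnd c hq]; simp

end Adjacency

section Cardinalities

variable {k : ℕ}

/-- The vertices of the chain of boxes as a sum type, used for counting them. -/
def boxVertexEquiv (k : ℕ) : BoxVertex k ≃ Fin (2 * k) ⊕ Fin k ⊕ Fin k where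
  toFun | .v i => .inl i | .a i => .inr (.inl i) | .b i => .inr (.inr i)
  invFun | .inl i => .v i | .inr (.inl i) => .a i | .inr (.inr i) => .b i
  left_inv := by rintro (i | i | i) <;> rfl
  right_inv := by rintro (i | i | i) <;> rfl

/-- The vertices of the gadget as a sum type, used for counting them. -/
def gadgetVertexEquiv (k : ℕ) :
    GadgetVertex k ≃ Fin 12 ⊕ Fin 4 × {p : BoxVertex k // ¬ p.IsEnd} where
  toFun | .cyc i => .inl i | .inner c p => .inr (c, p)
  invFun | .inl i => .cyc i | .inr (c, p) => .inner c p
  left_inv := by rintro (i | ⟨c, p⟩) <;> rfl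
  right_inv := by rintro (i | ⟨c, p⟩) <;> rfl

/-- The vertices of the counterexample graph as a sum type, used for counting them. -/
def gVertexEquiv (k : ℕ) : GVertex k ≃ Fin 4 ⊕ Fin 4 × GadgetVertex k where
  toFun | .t i => .inl i | .copy i p => .inr (i, p)
  invFun | .inl i => .t i | .inr (i, p) => .copy i p
  left_inv := by rintro (i | ⟨c, p⟩) <;> rfl
  right_inv := by rintro (i | ⟨c, p⟩) <;> rfl

theorem card_boxVertex : Fintype.card (BoxVertex k) = 4 * k := by
  rw [Fintype.card_congr (boxVertexEquiv k)]
  simp only [Fintype.card_sum, Fintype.card_fin]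
  ring

theorem card_isEnd (hk : 1 ≤ k) : Fintype.card {p : BoxVertex k // p.IsEnd} = 2 := by
  rw [Fintype.card_subtype, Finset.card_eq_two]
  refine ⟨.v ⟨0, by omega⟩, .v ⟨2 * k - 1, by omega⟩, ?_, ?_⟩
  · simp only [ne_eq, BoxVertex.v.injEq, Fin.ext_iff]
    omega
  · ext p
    rcases p with i | i | i
    · simp only [Finset.mem_filter, Finset.mem_univ, true_and, BoxVertex.isEnd_v,
        Finset.mem_insert, Finset.mem_singleton, BoxVertex.v.injEq, Fin.ext_iff]
      omega
    · simp [BoxVertex.not_isEnd_a]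
    · simp [BoxVertex.not_isEnd_b]

theorem card_not_isEnd (hk : 1 ≤ k) :
    Fintype.card {p : BoxVertex k // ¬ p.IsEnd} = 4 * k - 2 := by
  rw [Fintype.card_subtype_compl, card_isEnd hk, card_boxVertex]

theorem card_gadgetVertex (hk : 1 ≤ k) : Fintype.card (GadgetVertex k) = 16 * k + 4 := by
  rw [Fintype.card_congr (gadgetVertexEquiv k), Fintype.card_sum, Fintype.card_prod,
    card_not_isEnd hk, Fintype.card_fin, Fintype.card_fin]
  omega

theorem card_gVertex (hk : 1 ≤ k) : Fintype.card (GVertex k) = 64 * k + 20 := by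
  rw [Fintype.card_congr (gVertexEquiv k), Fintype.card_sum, Fintype.card_prod,
    card_gadgetVertex hk, Fintype.card_fin]
  omega

end Cardinalities

/-! ### Parity arguments -/

section Parity

variable {k : ℕ}

theorem IsMatching.even_card_of_closed {V : Type*} {G : SimpleGraph V} {M : Finset (Sym2 V)}
    (hM : IsMatching G M) {Y : Finset V} (h : ∀ x ∈ Y, ∃ y ∈ Y, s(x, y) ∈ M) : Even Y.card := by
  choose! f hfY hfM using h
  have hsum : ∑ _x ∈ Y, (1 : ZMod 2) = 0 := by
    refine Finset.sum_involution (fun x _ => f x) (fun _ _ => by decide) ?_ hfY ?_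
    · intro x hx _ hfx
      exact (hM.adj (hfM x hx)).ne hfx.symm
    · intro x hx
      exact hM.right_unique (hfM (f x) (hfY x hx)) (Sym2.eq_swap ▸ hfM x hx)
  rw [Finset.sum_const, nsmul_eq_mul, mul_one] at hsum
  exact (ZMod.natCast_eq_zero_iff_even).1 hsum

theorem IsMatching.matched_into_of_even {V : Type*} [Fintype V] [DecidableEq V]
    {G : SimpleGraph V} {M : Finset (Sym2 V)} (hM : IsMatching G M) {X : Finset V} {α β : V}
    (hX : Even X.card) (hα : α ∉ X) (hholes : ∀ x ∈ X, x ∉ holes M)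
    (hout : ∀ x ∈ X, ∀ y, s(x, y) ∈ M → y ∈ X ∨ y = α ∨ y = β) (h : ∃ x ∈ X, s(α, x) ∈ M) :
    ∃ x ∈ X, s(β, x) ∈ M := by
  by_contra! hcon
  have hodd : Even (insert α X).card := by
    refine hM.even_card_of_closed fun x hx => ?_
    rcases Finset.mem_insert.1 hx with rfl | hx
    · obtain ⟨y, hy, hxy⟩ := h
      exact ⟨y, Finset.mem_insert_of_mem hy, hxy⟩
    · obtain ⟨y, hy⟩ := not_mem_holes.1 (hholes x hx)
      refine ⟨y, ?_, hy⟩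
      rcases hout x hx y hy with hyX | rfl | rfl
      · exact Finset.mem_insert_of_mem hyX
      · exact Finset.mem_insert_self _ _
      · exact absurd (Sym2.eq_swap ▸ hy) (hcon x hx)
  rw [Finset.card_insert_of_notMem hα] at hodd
  exact Nat.even_add_one.1 hodd hX

/-- The set of inner vertices of the `c`-th chain of boxes in the `j`-th copy of the gadget. -/
def innSet (k : ℕ) (j c : Fin 4) : Finset (GVertex k) := Finset.univ.image (inn j c)

theorem mem_innSet {j c : Fin 4} {x : GVertex k} : x ∈ innSet k j c ↔ ∃ p, x = inn j c p := by
  simp [innSet, eq_comm]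

theorem even_card_innSet (hk : 1 ≤ k) (j c : Fin 4) : Even (innSet k j c).card := by
  rw [innSet, Finset.card_image_of_injective, Finset.card_univ, card_not_isEnd hk]
  · exact ⟨2 * k - 1, by omega⟩
  · intro p q h
    simpa using h

variable {M : Finset (Sym2 (GVertex k))}

theorem hub_matched_iff_tip_matched (hk : 1 ≤ k) (hM : IsMatching (counterexampleGraph k) M)
    {j c : Fin 4} (hholes : ∀ p, inn j c p ∉ holes M) :
    (∃ p, s(cy j (hub c), inn j c p) ∈ M) ↔ ∃ p, s(cy j (tip c), inn j c p) ∈ M := by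
  have hconv : ∀ x : GVertex k, (∃ p, s(x, inn j c p) ∈ M) ↔ ∃ y ∈ innSet k j c, s(x, y) ∈ M := by
    simp [innSet]
  have hholes' : ∀ x ∈ innSet k j c, x ∉ holes M := by
    intro x hx
    obtain ⟨p, rfl⟩ := mem_innSet.1 hx
    exact hholes p
  have hout : ∀ x ∈ innSet k j c, ∀ y, s(x, y) ∈ M →
      y ∈ innSet k j c ∨ y = cy j (hub c) ∨ y = cy j (tip c) := by
    intro x hx y hxy
    obtain ⟨p, rfl⟩ := mem_innSet.1 hx
    rw [mem_innSet]
    exact adj_inn_cases (hM.adj hxy)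
  have heven := even_card_innSet hk j c
  rw [hconv, hconv]
  constructor
  · exact hM.matched_into_of_even heven (by simp [mem_innSet]) hholes' hout
  · exact hM.matched_into_of_even heven (by simp [mem_innSet]) hholes'
      fun x hx y hxy => (hout x hx y hxy).imp_right Or.symm

theorem eq_mid_of_tip_mem (hk : 2 ≤ k) (hM : IsMatching (counterexampleGraph k) M)
    {j c : Fin 4} {y : GVertex k} (hholes : ∀ p, inn j c p ∉ holes M)
    (hmid : cy j (mid c) ∉ holes M) (h : s(cy j (tip c), y) ∈ M) (hy : y ≠ cy j (pole c)) :
    y = cy j (mid c) := by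
  rcases adj_tip_cases hk (hM.adj h) with rfl | rfl | ⟨p, rfl⟩
  · rfl
  · exact absurd rfl hy
  obtain ⟨q, hq⟩ := (hub_matched_iff_tip_matched (by omega) hM hholes).2 ⟨p, h⟩
  obtain ⟨z, hz⟩ := not_mem_holes.1 hmid
  rcases adj_mid_cases hk (hM.adj hz) with rfl | rfl
  · cases hM.right_unique hq (Sym2.eq_swap ▸ hz)
  · cases hM.right_unique h (Sym2.eq_swap ▸ hz)

/-- The vertices of the `j`-th copy of the gadget that `M` does not match within that copy. -/
def exits (M : Finset (Sym2 (GVertex k))) (j : Fin 4) : Finset (GadgetVertex k) :=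
  Finset.univ.filter fun r => ∀ s, s(.copy j r, .copy j s) ∉ M

theorem mem_exits {j : Fin 4} {r : GadgetVertex k} :
    r ∈ exits M j ↔ ∀ s, s(.copy j r, .copy j s) ∉ M := by simp [exits]

theorem mem_exits_of_mem_holes {j : Fin 4} {r : GadgetVertex k} (h : .copy j r ∈ holes M) :
    r ∈ exits M j :=
  mem_exits.2 fun _ hs => not_mem_holes_left hs h

theorem mem_exits_of_t_mem (hM : IsMatching (counterexampleGraph k) M) {i j : Fin 4}
    {r : GadgetVertex k} (h : s(.t i, .copy j r) ∈ M) : r ∈ exits M j := by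
  refine mem_exits.2 fun s hs => ?_
  cases hM.right_unique hs (Sym2.eq_swap ▸ h)

theorem exits_cases (hM : IsMatching (counterexampleGraph k) M) {j : Fin 4} {r : GadgetVertex k}
    (h : r ∈ exits M j) : .copy j r ∈ holes M ∨ (r = .cyc 3 ∧ s(.t j, cy j 3) ∈ M) ∨
      (r = .cyc 9 ∧ s(.t (j + 1), cy j 9) ∈ M) := by
  by_contra! hcon
  obtain ⟨y, hy⟩ := not_mem_holes.1 hcon.1
  rcases adj_copy_cases (hM.adj hy) with ⟨s, rfl, -⟩ | ⟨rfl, rfl⟩ | ⟨rfl, rfl⟩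
  · exact mem_exits.1 h s hy
  · exact hcon.2.1 rfl (Sym2.eq_swap ▸ hy)
  · exact hcon.2.2 rfl (Sym2.eq_swap ▸ hy)

-- The other vertices of the copy are matched among themselves, and the copy has `16 k + 4`
-- vertices.
theorem even_card_exits (hk : 1 ≤ k) (hM : IsMatching (counterexampleGraph k) M) (j : Fin 4) :
    Even (exits M j).card := by
  have hcompl : Even (((exits M j)ᶜ).image (GVertex.copy j)).card := by
    refine hM.even_card_of_closed fun x hx => ?_
    obtain ⟨r, hr, rfl⟩ := Finset.mem_image.1 hx
    simp only [Finset.mem_compl, mem_exits, not_forall, not_not] at hr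
    obtain ⟨s, hs⟩ := hr
    refine ⟨.copy j s, Finset.mem_image_of_mem _ ?_, hs⟩
    rw [Finset.mem_compl, mem_exits, not_forall]
    exact ⟨r, not_not.2 (Sym2.eq_swap ▸ hs)⟩
  rw [Finset.card_image_of_injective _ fun _ _ h => (GVertex.copy.inj h).2] at hcompl
  have hcard := Finset.card_add_card_compl (exits M j)
  rw [card_gadgetVertex hk] at hcard
  have htotal : Even (16 * k + 4) := ⟨8 * k + 2, by ring⟩
  rw [← hcard, Nat.even_add] at htotal
  exact htotal.2 hcompl

end Parity

/-! ### The cut -/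

section Flags

variable {k : ℕ} {M N : Finset (Sym2 (GVertex k))} {j : Fin 4}

/-- The holes in the `j`-th copy of the gadget. -/
def gadgetHoles (M : Finset (Sym2 (GVertex k))) (j : Fin 4) : Finset (GadgetVertex k) :=
  Finset.univ.filter fun r => .copy j r ∈ holes M

theorem mem_gadgetHoles {r : GadgetVertex k} : r ∈ gadgetHoles M j ↔ .copy j r ∈ holes M := by
  simp [gadgetHoles]

/-- The two vertices `u` and `v` of the `j`-th copy of the gadget are not matched within that
copy. -/
def Flag (M : Finset (Sym2 (GVertex k))) (j : Fin 4) : Prop :=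
  .cyc 3 ∈ exits M j ∧ .cyc 9 ∈ exits M j

/-- The bottleneck configurations: the only hole of the `j`-th copy of the gadget is `mid c`, and
`tip c` is matched to `pole c`. -/
def Rare (M : Finset (Sym2 (GVertex k))) (j c : Fin 4) : Prop :=
  gadgetHoles M j = {.cyc (mid c)} ∧ s(cy j (pole c), cy j (tip c)) ∈ M

theorem exits_subset (hM : IsMatching (counterexampleGraph k) M) (j : Fin 4) :
    exits M j ⊆ gadgetHoles M j ∪ {.cyc 3, .cyc 9} := by
  intro r hr
  rcases exits_cases hM hr with h | ⟨rfl, -⟩ | ⟨rfl, -⟩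
  · exact Finset.mem_union_left _ (mem_gadgetHoles.2 h)
  · simp
  · simp

theorem flag_of_mem_exits (hk : 1 ≤ k) (hM : IsMatching (counterexampleGraph k) M)
    (hholes : gadgetHoles M j ⊆ {.cyc 3, .cyc 9}) {r : GadgetVertex k} (hr : r ∈ exits M j) :
    Flag M j := by
  have hsub : exits M j ⊆ {.cyc 3, .cyc 9} :=
    (exits_subset hM j).trans (Finset.union_subset hholes subset_rfl)
  have heq : exits M j = {.cyc 3, .cyc 9} := by
    refine Finset.eq_of_subset_of_card_le hsub ?_
    have hpos := Finset.card_pos.2 ⟨r, hr⟩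
    obtain ⟨n, hn⟩ := even_card_exits hk hM j
    have hle : ({.cyc 3, .cyc 9} : Finset (GadgetVertex k)).card ≤ 2 := Finset.card_le_two
    omega
  constructor <;> simp [heq]

theorem not_flag_of_gadgetHoles_eq (hk : 1 ≤ k) (hM : IsMatching (counterexampleGraph k) M)
    {r : GadgetVertex k} (hr : gadgetHoles M j = {r}) (h3 : r ≠ .cyc 3) (h9 : r ≠ .cyc 9) :
    ¬ Flag M j := by
  rintro ⟨hu, hv⟩
  have hrE : r ∈ exits M j :=
    mem_exits_of_mem_holes (mem_gadgetHoles.1 (hr ▸ Finset.mem_singleton_self r))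
  have heq : exits M j = {r, .cyc 3, .cyc 9} := by
    refine (hr ▸ exits_subset hM j).antisymm ?_
    simp [Finset.insert_subset_iff, hrE, hu, hv]
  have hcard := even_card_exits hk hM j
  rw [heq, Finset.card_eq_three.2 ⟨r, _, _, h3, h9, by simp, rfl⟩] at hcard
  exact absurd hcard (by decide)

theorem flag_iff_u_mem (hk : 1 ≤ k) (hM : IsMatching (counterexampleGraph k) M)
    (hholes : gadgetHoles M j = ∅) : Flag M j ↔ s(.t j, cy j 3) ∈ M := by
  constructor
  · intro h
    rcases exits_cases hM h.1 with h | ⟨-, h⟩ | ⟨h, -⟩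
    · exact absurd (mem_gadgetHoles.2 h) (by simp [hholes])
    · exact h
    · simp at h
  · exact fun h => flag_of_mem_exits hk hM (by simp [hholes]) (mem_exits_of_t_mem hM h)

theorem flag_iff_v_mem (hk : 1 ≤ k) (hM : IsMatching (counterexampleGraph k) M)
    (hholes : gadgetHoles M j = ∅) : Flag M j ↔ s(.t (j + 1), cy j 9) ∈ M := by
  constructor
  · intro h
    rcases exits_cases hM h.2 with h | ⟨h, -⟩ | ⟨-, h⟩
    · exact absurd (mem_gadgetHoles.2 h) (by simp [hholes])
    · simp at h
    · exact h
  · exact fun h => flag_of_mem_exits hk hM (by simp [hholes]) (mem_exits_of_t_mem hM h)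

theorem flag_add_one_iff (hk : 1 ≤ k) (hM : IsMatching (counterexampleGraph k) M)
    (hj : gadgetHoles M j = ∅) (hj' : gadgetHoles M (j + 1) = ∅) (ht : .t (j + 1) ∉ holes M) :
    Flag M (j + 1) ↔ ¬ Flag M j := by
  rw [flag_iff_u_mem hk hM hj', flag_iff_v_mem hk hM hj]
  constructor
  · intro hu hv
    simpa using hM.right_unique hu hv
  · intro hv
    obtain ⟨y, hy⟩ := not_mem_holes.1 ht
    rcases adj_t_cases (hM.adj hy) with rfl | rfl
    · exact hy
    · rw [add_sub_cancel_right] at hy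
      exact absurd hy hv

theorem exists_tip_mem_of_not_flag (hk : 2 ≤ k) (hM : IsMatching (counterexampleGraph k) M)
    (h : ¬ Flag M j) : ∃ c, s(cy j (pole c), cy j (tip c)) ∈ M := by
  obtain ⟨c, hc⟩ : ∃ c, .cyc (pole c) ∉ exits M j := by
    by_contra! hcon
    exact h ⟨hcon 0, hcon 1⟩
  simp only [mem_exits, not_forall, not_not] at hc
  obtain ⟨s, hs⟩ := hc
  rcases adj_pole_cases hk (hM.adj hs) with hy | hy | ⟨i, hy⟩
  · exact ⟨c, hy ▸ hs⟩
  · have pole_add_two : ∀ c, pole (c + 2) = pole c := by decide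
    exact ⟨c + 2, by rw [pole_add_two, ← hy]; exact hs⟩
  · cases hy

theorem gadgetHoles_eq_singleton (hc : (gadgetHoles M j).card ≤ 1) {r : GadgetVertex k}
    (hr : .copy j r ∈ holes M) : gadgetHoles M j = {r} :=
  (Finset.eq_of_subset_of_card_le (Finset.singleton_subset_iff.2 (mem_gadgetHoles.2 hr))
    (by simpa using hc)).symm

theorem flag_pole_mem_exits (hF : Flag M j) (c : Fin 4) : .cyc (pole c) ∈ exits M j := by
  have hpole : pole c = 3 ∨ pole c = 9 := by revert c; decide
  rcases hpole with h | h <;> rw [h]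
  exacts [hF.1, hF.2]

theorem rare_slide (hk : 2 ≤ k) (hM : IsMatching (counterexampleGraph k) M) {c : Fin 4}
    (hsingle : gadgetHoles M j = {.cyc (pole c)}) {y : GVertex k} (h : s(cy j (tip c), y) ∈ M) :
    Rare (insert s(cy j (tip c), cy j (pole c)) (M.erase s(cy j (tip c), y))) j c := by
  have mid_ne : ∀ c, mid c ≠ pole c := by decide
  have hp : cy j (pole c) ∈ holes M := mem_gadgetHoles.1 (by simp [hsingle])
  have hne : ∀ r : GadgetVertex k, r ≠ .cyc (pole c) → .copy j r ∉ holes M := by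
    intro r hr hrM
    rw [← mem_gadgetHoles, hsingle] at hrM
    exact hr (Finset.mem_singleton.1 hrM)
  obtain rfl : y = cy j (mid c) := eq_mid_of_tip_mem hk hM (fun p => hne _ (by simp))
    (hne _ (by simpa using mid_ne c)) h fun hy => not_mem_holes_right h (hy ▸ hp)
  refine ⟨?_, Finset.mem_insert.2 (Or.inl Sym2.eq_swap)⟩
  ext r
  rw [mem_gadgetHoles, hM.holes_slide h hp]
  simp only [Finset.mem_insert, GVertex.copy.injEq, true_and, Finset.mem_erase,
    Finset.mem_singleton, or_iff_left_iff_imp]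
  exact fun hr => absurd hr.2 (hne r fun h => hr.1 (by rw [h]))

-- The move adds an edge `{pole c, tip c}`. If `tip c` was the hole, then there was no flag by
-- parity; if `pole c` was the hole, then the partner of `tip c` was `mid c`.
theorem BroderStep.exists_rare (hk : 2 ≤ k) (hM : IsMatching (counterexampleGraph k) M)
    (hN : IsMatching (counterexampleGraph k) N) (h : BroderStep (counterexampleGraph k) M N)
    (hc : (gadgetHoles M j).card ≤ 1) (hMF : Flag M j) (hNF : ¬ Flag N j) : ∃ c, Rare N j c := by
  have tip_ne : ∀ c, tip c ≠ 3 ∧ tip c ≠ 9 ∧ tip c ≠ pole c := by decide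
  obtain ⟨c, hcN⟩ := exists_tip_mem_of_not_flag hk hN hNF
  have hcM : s(cy j (pole c), cy j (tip c)) ∉ M := mem_exits.1 (flag_pole_mem_exits hMF c) _
  have htip : cy j (tip c) ∉ holes M := fun htip =>
    not_flag_of_gadgetHoles_eq (by omega) hM (gadgetHoles_eq_singleton hc htip)
      (by simpa using (tip_ne c).1) (by simpa using (tip_ne c).2.1) hMF
  rcases h with ⟨p, q, hp, hq, -, rfl⟩ | ⟨p, q, -, -, -, rfl⟩ | ⟨x, y, p, hxy, hp, -, rfl⟩
  · rcases Sym2.eq_iff.1 ((Finset.mem_insert.1 hcN).resolve_right hcM) with ⟨-, rfl⟩ | ⟨-, rfl⟩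
    exacts [absurd hq htip, absurd hp htip]
  · exact absurd (Finset.mem_insert_of_mem hcN) hcM
  obtain ⟨rfl, rfl⟩ : cy j (pole c) = p ∧ cy j (tip c) = x := by
    rcases Sym2.eq_iff.1 ((Finset.mem_insert.1 hcN).resolve_right
      fun h => hcM (Finset.mem_of_mem_erase h)) with ⟨-, rfl⟩ | ⟨rfl, rfl⟩
    exacts [absurd hp htip, ⟨rfl, rfl⟩]
  exact ⟨c, rare_slide hk hM (gadgetHoles_eq_singleton hc hp) hxy⟩

theorem BroderStep.flag_iff (hk : 2 ≤ k) (hM : IsMatching (counterexampleGraph k) M)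
    (hN : IsMatching (counterexampleGraph k) N) (h : BroderStep (counterexampleGraph k) M N)
    (hMc : (gadgetHoles M j).card ≤ 1) (hNc : (gadgetHoles N j).card ≤ 1)
    (hMr : ∀ c, ¬ Rare M j c) (hNr : ∀ c, ¬ Rare N j c) : Flag M j ↔ Flag N j := by
  constructor
  · intro hF
    by_contra hnF
    obtain ⟨c, hc⟩ := h.exists_rare hk hM hN hMc hF hnF
    exact hNr c hc
  · intro hF
    by_contra hnF
    obtain ⟨c, hc⟩ := (h.symm hM).exists_rare hk hN hM hNc hF hnF
    exact hMr c hc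

end Flags

section Cut

variable {k : ℕ} {M N : Finset (Sym2 (GVertex k))} {j : Fin 4}

theorem image_gadgetHoles_subset (j : Fin 4) : (gadgetHoles M j).image (.copy j) ⊆ holes M := by
  intro x hx
  obtain ⟨r, hr, rfl⟩ := Finset.mem_image.1 hx
  exact mem_gadgetHoles.1 hr

theorem card_image_copy (j : Fin 4) (A : Finset (GadgetVertex k)) :
    (A.image (GVertex.copy j)).card = A.card :=
  Finset.card_image_of_injective _ fun _ _ h => (GVertex.copy.inj h).2

theorem exists_eq_copy_of_two_le (hc : (holes M).card ≤ 2) (h : 2 ≤ (gadgetHoles M j).card)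
    {x : GVertex k} (hx : x ∈ holes M) : ∃ r, x = .copy j r := by
  rw [← Finset.eq_of_subset_of_card_le (image_gadgetHoles_subset j)
    (by rw [card_image_copy]; omega)] at hx
  obtain ⟨r, -, rfl⟩ := Finset.mem_image.1 hx
  exact ⟨r, rfl⟩

theorem BroderStep.card_gadgetHoles_le_one (hM : IsMatching (counterexampleGraph k) M)
    (hMc : (holes M).card ≤ 2) (hNc : (holes N).card ≤ 2)
    (h : BroderStep (counterexampleGraph k) M N) {i : Fin 4} (hij : i ≠ j)
    (hj : 2 ≤ (gadgetHoles M j ∪ gadgetHoles N j).card) :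
    (gadgetHoles M i ∪ gadgetHoles N i).card ≤ 1 := by
  have hsub : ∀ i, (gadgetHoles M i ∪ gadgetHoles N i).image (.copy i) ⊆ holes M ∪ holes N := by
    intro i
    rw [Finset.image_union]
    exact Finset.union_subset_union (image_gadgetHoles_subset i) (image_gadgetHoles_subset i)
  have hdisj : Disjoint ((gadgetHoles M i ∪ gadgetHoles N i).image (GVertex.copy i))
      ((gadgetHoles M j ∪ gadgetHoles N j).image (.copy j)) := by
    simp only [Finset.disjoint_left, Finset.mem_image]
    rintro _ ⟨r, -, rfl⟩ ⟨s, -, hs⟩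
    exact hij (GVertex.copy.inj hs).1.symm
  have hle := Finset.card_le_card (Finset.union_subset (hsub i) (hsub j))
  rw [Finset.card_union_of_disjoint hdisj, card_image_copy, card_image_copy] at hle
  have := h.card_union_holes_le hM hMc hNc
  omega

open Classical in
/-- The copies of the gadget whose flag is as in a perfect matching in which `u` and `v` are matched
to the outside in the copies with even index. -/
def agree (M : Finset (Sym2 (GVertex k))) : Finset (Fin 4) :=
  Finset.univ.filter fun j => Flag M j ↔ Even (j : ℕ)

theorem mem_agree : j ∈ agree M ↔ (Flag M j ↔ Even (j : ℕ)) := by simp [agree]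

theorem mem_agree_add_one_iff (hk : 1 ≤ k) (hM : IsMatching (counterexampleGraph k) M)
    (hj : gadgetHoles M j = ∅) (hj' : gadgetHoles M (j + 1) = ∅) (ht : .t (j + 1) ∉ holes M) :
    j + 1 ∈ agree M ↔ j ∈ agree M := by
  have even_add_one : ∀ j : Fin 4, Even ((j + 1 : Fin 4) : ℕ) ↔ ¬ Even (j : ℕ) := by decide
  rw [mem_agree, mem_agree, flag_add_one_iff hk hM hj hj' ht, even_add_one, not_iff_not]

theorem mem_agree_iff_of_ne (hk : 1 ≤ k) (hM : IsMatching (counterexampleGraph k) M)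
    (h : ∀ x ∈ holes M, ∃ r, x = .copy j r) {i i' : Fin 4} (hi : i ≠ j) (hi' : i' ≠ j) :
    i ∈ agree M ↔ i' ∈ agree M := by
  have add_ne : ∀ j : Fin 4, j + 1 ≠ j ∧ j + 1 + 1 ≠ j ∧ j + 1 + 1 + 1 ≠ j := by decide
  have cases_of_ne : ∀ i j : Fin 4, i ≠ j → i = j + 1 ∨ i = j + 1 + 1 ∨ i = j + 1 + 1 + 1 := by
    decide
  have ht : ∀ i, .t i ∉ holes M := fun i hi => by simpa using h _ hi
  have hempty : ∀ i, i ≠ j → gadgetHoles M i = ∅ := by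
    intro i hi
    refine Finset.eq_empty_of_forall_notMem fun r hr => ?_
    obtain ⟨s, hs⟩ := h _ (mem_gadgetHoles.1 hr)
    exact hi (GVertex.copy.inj hs).1
  have hstep : ∀ i, i ≠ j → i + 1 ≠ j → (i + 1 ∈ agree M ↔ i ∈ agree M) := fun i hi hi' =>
    mem_agree_add_one_iff hk hM (hempty i hi) (hempty _ hi') (ht _)
  have hbase : ∀ i, i ≠ j → (i ∈ agree M ↔ j + 1 ∈ agree M) := by
    intro i hi
    have h1 := hstep (j + 1) (add_ne j).1 (add_ne j).2.1
    have h2 := hstep (j + 1 + 1) (add_ne j).2.1 (add_ne j).2.2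
    rcases cases_of_ne i j hi with rfl | rfl | rfl
    exacts [Iff.rfl, h1, h2.trans h1]
  rw [hbase i hi, hbase i' hi']

theorem card_agree_ne_two (hk : 1 ≤ k) (hM : IsMatching (counterexampleGraph k) M)
    (h : holes M = ∅) : (agree M).card ≠ 2 := by
  have hall : ∀ i, i ∈ agree M ↔ 1 ∈ agree M := by
    have hne : ∀ i : Fin 4, ∃ j, i ≠ j ∧ 1 ≠ j := by decide
    intro i
    obtain ⟨j, hi, h1⟩ := hne i
    exact mem_agree_iff_of_ne hk hM (by simp [h]) hi h1
  by_cases h1 : 1 ∈ agree M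
  · rw [Finset.eq_univ_of_forall fun i => (hall i).2 h1]; decide
  · rw [Finset.eq_empty_of_forall_notMem fun i hi => h1 ((hall i).1 hi)]; decide

-- If one copy contains both holes before or after the move, then the flags of the other three
-- copies are unchanged, and these copies belong to `agree` either all or not at all.
theorem BroderStep.three_le_card_agree (hk : 2 ≤ k) (hM : IsMatching (counterexampleGraph k) M)
    (hN : IsMatching (counterexampleGraph k) N) (hMc : (holes M).card ≤ 2)
    (hNc : (holes N).card ≤ 2) (h : BroderStep (counterexampleGraph k) M N)
    (hMr : ∀ j c, ¬ Rare M j c) (hNr : ∀ j c, ¬ Rare N j c) (h3 : 3 ≤ (agree M).card) :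
    3 ≤ (agree N).card := by
  have hiff : ∀ j, (gadgetHoles M j).card ≤ 1 → (gadgetHoles N j).card ≤ 1 →
      (j ∈ agree M ↔ j ∈ agree N) := by
    intro j h1 h2
    rw [mem_agree, mem_agree, h.flag_iff hk hM hN h1 h2 (hMr j) (hNr j)]
  by_cases hb : ∃ j, 2 ≤ (gadgetHoles M j).card ∨ 2 ≤ (gadgetHoles N j).card
  · obtain ⟨j, hj⟩ := hb
    have hMN := Finset.card_le_card (Finset.subset_union_left (s₁ := gadgetHoles M j)
      (s₂ := gadgetHoles N j))
    have hNM := Finset.card_le_card (Finset.subset_union_right (s₁ := gadgetHoles M j)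
      (s₂ := gadgetHoles N j))
    have hoff : ∀ i, i ≠ j → (i ∈ agree M ↔ i ∈ agree N) := by
      intro i hi
      have hi1 := h.card_gadgetHoles_le_one hM hMc hNc hi (by omega)
      exact hiff i ((Finset.card_le_card Finset.subset_union_left).trans hi1)
        ((Finset.card_le_card Finset.subset_union_right).trans hi1)
    obtain ⟨i, hiM, hi⟩ := Finset.exists_mem_ne (by omega : 1 < (agree M).card) j
    have hall : ({j}ᶜ : Finset (Fin 4)) ⊆ agree N := by
      intro i' hi'
      have hi' : i' ≠ j := by simpa using hi'
      rcases hj with hj | hj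
      · exact (hoff i' hi').1 ((mem_agree_iff_of_ne (by omega) hM
          (fun _ => exists_eq_copy_of_two_le hMc hj) hi' hi).2 hiM)
      · exact (mem_agree_iff_of_ne (by omega) hN
          (fun _ => exists_eq_copy_of_two_le hNc hj) hi' hi).2 ((hoff i hi).1 hiM)
    simpa [Finset.card_compl] using Finset.card_le_card hall
  · push Not at hb
    have : agree M = agree N := by
      ext j
      exact hiff j (Nat.le_of_lt_succ (hb j).1) (Nat.le_of_lt_succ (hb j).2)
    rwa [← this]

end Cut

/-! ### Matchings of a chain of boxes -/

section BoxMatchings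

variable {k : ℕ}

/-- The perfect matching of the inner vertices of a chain of boxes, as an involution that fixes the
two ends. -/
def innerPartner : BoxVertex k → BoxVertex k
  | .v i => if (i : ℕ) % 2 = 0 then .v ⟨i - 1, by omega⟩
      else if h : (i : ℕ) + 1 < 2 * k then .v ⟨i + 1, h⟩ else .v i
  | .a i => .b i
  | .b i => .a i

theorem innerPartner_innerPartner (p : BoxVertex k) : innerPartner (innerPartner p) = p := by
  rcases p with ⟨i, hi⟩ | i | i
  · simp only [innerPartner]
    split_ifs <;> grind [innerPartner]
  · rfl
  · rfl

theorem not_isEnd_innerPartner {p : BoxVertex k} (hp : ¬ p.IsEnd) : ¬ (innerPartner p).IsEnd := by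
  rcases p with i | i | i
  · rw [BoxVertex.isEnd_v] at hp
    simp only [innerPartner]
    split_ifs <;> simp only [BoxVertex.isEnd_v] <;> omega
  · exact BoxVertex.not_isEnd_b
  · exact BoxVertex.not_isEnd_a

theorem boxChain_adj_innerPartner {p : BoxVertex k} (hp : ¬ p.IsEnd) :
    (boxChain k).Adj p (innerPartner p) := by
  rw [boxChain_adj]
  rcases p with i | i | i
  · rw [BoxVertex.isEnd_v] at hp
    simp only [innerPartner]
    split_ifs <;> grind [BoxRel]
  · simp [innerPartner, BoxRel]
  · simp [innerPartner, BoxRel]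

/-- The perfect matchings of a chain of boxes, as involutions. For each `i`, the choice is between
`{v (2i), v (2i+1)}, {a i, b i}` and `{v (2i), a i}, {b i, v (2i+1)}`. -/
def boxPartner (s : Fin k → Bool) : BoxVertex k → BoxVertex k
  | .v i => if s ⟨i / 2, by omega⟩ then
        (if (i : ℕ) % 2 = 0 then .v ⟨2 * (i / 2) + 1, by omega⟩ else .v ⟨2 * (i / 2), by omega⟩)
      else (if (i : ℕ) % 2 = 0 then .a ⟨i / 2, by omega⟩ else .b ⟨i / 2, by omega⟩)
  | .a i => if s i then .b i else .v ⟨2 * i, by omega⟩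
  | .b i => if s i then .a i else .v ⟨2 * i + 1, by omega⟩

theorem boxPartner_boxPartner (s : Fin k → Bool) (p : BoxVertex k) :
    boxPartner s (boxPartner s p) = p := by
  rcases p with ⟨i, hi⟩ | i | i <;> simp only [boxPartner] <;> split_ifs <;>
    grind [boxPartner]

theorem boxChain_adj_boxPartner (s : Fin k → Bool) (p : BoxVertex k) :
    (boxChain k).Adj p (boxPartner s p) := by
  rw [boxChain_adj]
  rcases p with i | i | i <;> simp only [boxPartner] <;> split_ifs <;>
    grind [BoxRel]

theorem boxPartner_a_injective {s s' : Fin k → Bool}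
    (h : ∀ i, boxPartner s (.a i) = boxPartner s' (.a i)) : s = s' := by
  funext i
  have hi := h i
  cases hs : s i <;> cases hs' : s' i <;> simp [boxPartner, hs, hs'] at hi ⊢

/-- The relation `R` is a partial matching that matches each inner vertex of the chain of boxes to
an adjacent inner vertex. -/
structure MatchesInner (R : BoxVertex k → BoxVertex k → Prop) : Prop where
  symm : ∀ p q, R p q → R q p
  right_unique : ∀ p q q', R p q → R p q' → q = q'
  exists_adj : ∀ p, ¬ p.IsEnd → ∃ q, ¬ q.IsEnd ∧ (boxChain k).Adj p q ∧ R p q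

namespace MatchesInner

variable {R : BoxVertex k → BoxVertex k → Prop}

theorem eq_v_pred (h : MatchesInner R) {i : ℕ}
    (hprev : ∀ x y : Fin (2 * k), (x : ℕ) + 1 = y → (y : ℕ) = 2 * i → R (.v x) (.v y))
    {y : Fin (2 * k)} (hy : (y : ℕ) = 2 * i) (hend : ¬ (BoxVertex.v y).IsEnd) {p : BoxVertex k}
    (hp : R p (.v y)) : ∃ x : Fin (2 * k), (x : ℕ) + 1 = y ∧ p = .v x := by
  rw [BoxVertex.isEnd_v] at hend
  have hx : (y : ℕ) - 1 + 1 = y := by omega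
  exact ⟨⟨y - 1, by omega⟩, hx, h.right_unique _ _ _ (h.symm _ _ hp)
    (h.symm _ _ (hprev ⟨y - 1, by omega⟩ y hx hy))⟩

theorem a_b (h : MatchesInner R) {i : Fin k}
    (hprev : ∀ x y : Fin (2 * k), (x : ℕ) + 1 = y → (y : ℕ) = 2 * i → R (.v x) (.v y)) :
    R (.a i) (.b i) := by
  obtain ⟨q, hq, hadj, hR⟩ := h.exists_adj (.a i) BoxVertex.not_isEnd_a
  rw [boxChain_adj] at hadj
  rcases q with y | l | l <;> simp only [BoxRel, false_or, or_false] at hadj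
  · obtain ⟨x, -, hx⟩ := h.eq_v_pred hprev hadj hq hR
    cases hx
  · exact hadj ▸ hR

theorem v_v_succ (h : MatchesInner R) {i : Fin k}
    (hprev : ∀ x y : Fin (2 * k), (x : ℕ) + 1 = y → (y : ℕ) = 2 * i → R (.v x) (.v y))
    {x y : Fin (2 * k)} (hxy : (x : ℕ) + 1 = y) (hx : (x : ℕ) = 2 * i + 1) : R (.v x) (.v y) := by
  have hend : ¬ (BoxVertex.v x).IsEnd := by rw [BoxVertex.isEnd_v]; omega
  obtain ⟨q, hq, hadj, hR⟩ := h.exists_adj _ hend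
  rw [boxChain_adj] at hadj
  rcases q with l | l | l <;> simp only [BoxRel, false_or, or_false] at hadj
  · rcases hadj with hl | hl
    · rwa [Fin.ext (hxy.symm.trans hl)]
    · obtain ⟨z, hz, hzx⟩ := h.eq_v_pred hprev (by omega) hq hR
      cases hzx
      omega
  · omega
  · obtain rfl : i = l := Fin.ext (by omega)
    cases h.right_unique _ _ _ (h.symm _ _ hR) (h.symm _ _ (h.a_b hprev))

theorem v_v (h : MatchesInner R) {i : ℕ} {x y : Fin (2 * k)} (hxy : (x : ℕ) + 1 = y)
    (hy : (y : ℕ) = 2 * i) : R (.v x) (.v y) := by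
  induction i generalizing x y with
  | zero => omega
  | succ i ih => exact h.v_v_succ (i := ⟨i, by omega⟩) (fun _ _ => ih) hxy (by simp only; omega)

theorem rel_innerPartner (h : MatchesInner R) {p : BoxVertex k} (hp : ¬ p.IsEnd) :
    R p (innerPartner p) := by
  have hab : ∀ i, R (.a i) (.b i) := fun i => h.a_b fun _ _ => h.v_v
  rcases p with i | i | i
  · rw [BoxVertex.isEnd_v] at hp
    simp only [innerPartner]
    split_ifs
    · exact h.symm _ _ (h.v_v (i := i / 2) (by simp only; omega) (by omega))
    · exact h.v_v (i := i / 2 + 1) rfl (by simp only; omega)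
    · omega
  · exact hab i
  · exact h.symm _ _ (hab i)

end MatchesInner

end BoxMatchings

/-! ### Switching -/

theorem card_mul_sum_filter_le {S T : Type*} [Fintype S] [Fintype T] {p : S → Prop}
    [DecidablePred p] {Φ : {x // p x} → T → S} (hΦ : Function.Injective2 Φ) {w : S → ℝ}
    (hw : ∀ x, 0 ≤ w x) (hwΦ : ∀ x s, w (Φ x s) = w x) :
    Fintype.card T * ∑ x with p x, w x ≤ ∑ x, w x := by
  calc Fintype.card T * ∑ x with p x, w x
      = ∑ q : {x // p x} × T, w (Φ q.1 q.2) := by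
        rw [Fintype.sum_prod_type, Finset.mul_sum,
          Finset.sum_subtype (Finset.univ.filter p) (p := p) (F := inferInstance)
            (by simp)]
        simp only [hwΦ, Finset.sum_const, Finset.card_univ, nsmul_eq_mul]
    _ = ∑ x ∈ Finset.univ.map ⟨Function.uncurry Φ, hΦ.uncurry⟩, w x := by
        rw [Finset.sum_map]; rfl
    _ ≤ ∑ x, w x := Finset.sum_le_univ_sum_of_nonneg hw

section Switch

variable {V : Type*} [DecidableEq V] {G : SimpleGraph V} {M D A B : Finset (Sym2 V)}

/-- The image under `χ` of the matching of `X` given by the involution `f`. -/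
def involutionMatching {W : Type*} (χ : W → V) (X : Finset W) (f : W → W) : Finset (Sym2 V) :=
  X.image fun p => s(χ p, χ (f p))

theorem isMatching_involutionMatching {W : Type*} {χ : W → V} (hχ : Function.Injective χ)
    {X : Finset W} {f : W → W} (hf : ∀ p ∈ X, f (f p) = p)
    (hadj : ∀ p ∈ X, G.Adj (χ p) (χ (f p))) : IsMatching G (involutionMatching χ X f) := by
  constructor
  · intro e he
    obtain ⟨p, hp, rfl⟩ := Finset.mem_image.1 he
    exact hadj p hp
  · intro e he e' he' v hv hv'
    obtain ⟨p, hp, rfl⟩ := Finset.mem_image.1 he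
    obtain ⟨q, hq, rfl⟩ := Finset.mem_image.1 he'
    rcases Sym2.mem_iff.1 hv with rfl | rfl <;> rcases Sym2.mem_iff.1 hv' with h | h <;>
      have h := hχ h
    · rw [h]
    · rw [h, hf q hq, Sym2.eq_swap]
    · rw [← h, hf p hp, Sym2.eq_swap]
    · rw [← hf p hp, h, hf q hq]

variable [Fintype V]

theorem mem_holes_involutionMatching {W : Type*} {χ : W → V} {X : Finset W} {f : W → W}
    (hfX : ∀ p ∈ X, f p ∈ X) {v : V} :
    v ∈ holes (involutionMatching χ X f) ↔ ∀ p ∈ X, v ≠ χ p := by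
  rw [mem_holes]
  constructor
  · rintro h p hp rfl
    exact h _ (Finset.mem_image_of_mem _ hp) (Sym2.mem_mk_left _ _)
  · intro h e he hv
    obtain ⟨p, hp, rfl⟩ := Finset.mem_image.1 he
    rcases Sym2.mem_iff.1 hv with rfl | rfl
    exacts [h p hp rfl, h _ (hfX p hp) rfl]

theorem IsMatching.mem_holes_sdiff (hM : IsMatching G M) (hD : D ⊆ M) {v : V}
    (hv : v ∉ holes D) : v ∈ holes (M \ D) := by
  obtain ⟨y, hy⟩ := not_mem_holes.1 hv
  rw [mem_holes]
  intro e he hve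
  obtain ⟨he, heD⟩ := Finset.mem_sdiff.1 he
  exact heD (hM.2 _ he _ (hD hy) v hve (Sym2.mem_mk_left _ _) ▸ hy)

theorem IsMatching.eq_of_subset (hM : IsMatching G M) (hA : A ⊆ M) (hB : B ⊆ M)
    (h : holes A = holes B) : A = B := by
  have hsub : ∀ {A B : Finset (Sym2 V)}, A ⊆ M → B ⊆ M → holes A = holes B → A ⊆ B := by
    intro A B hA hB h e he
    induction e with
    | _ x y =>
      obtain ⟨z, hz⟩ := not_mem_holes.1 (h ▸ not_mem_holes_left he)
      rwa [hM.right_unique (hA he) (hB hz)]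
  exact (hsub hA hB h).antisymm (hsub hB hA h.symm)

theorem IsMatching.switch (hM : IsMatching G M) (hD : D ⊆ M) (hA : IsMatching G A)
    (hDA : holes A = holes D) : IsMatching G (M \ D ∪ A) := by
  have hdisj : ∀ e ∈ M \ D, ∀ f ∈ A, ∀ v, v ∈ e → v ∉ f := by
    intro e he f hf v hve hvf
    have hv : v ∉ holes D := by rw [← hDA, mem_holes]; exact fun h => h f hf hvf
    exact mem_holes.1 (hM.mem_holes_sdiff hD hv) e he hve
  constructor
  · intro e he
    rcases Finset.mem_union.1 he with he | he
    exacts [hM.1 e (Finset.mem_sdiff.1 he).1, hA.1 e he]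
  · intro e he f hf v hve hvf
    rcases Finset.mem_union.1 he with he | he <;> rcases Finset.mem_union.1 hf with hf | hf
    · exact hM.2 e (Finset.mem_sdiff.1 he).1 f (Finset.mem_sdiff.1 hf).1 v hve hvf
    · exact absurd hvf (hdisj e he f hf v hve)
    · exact absurd hve (hdisj f hf e he v hvf)
    · exact hA.2 e he f hf v hve hvf

theorem holes_switch (hD : D ⊆ M) (hDA : holes A = holes D) :
    holes (M \ D ∪ A) = holes M := by
  have holes_union : ∀ A B : Finset (Sym2 V), holes (A ∪ B) = holes A ∩ holes B := by
    intro A B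
    ext v
    simp only [mem_holes, Finset.mem_inter, Finset.mem_union, or_imp, forall_and]
  rw [holes_union, hDA, ← holes_union, Finset.sdiff_union_of_subset hD]

theorem IsMatching.switch_switch (hM : IsMatching G M) (hD : D ⊆ M) (hDA : holes A = holes D) :
    (M \ D ∪ A) \ A ∪ D = M := by
  have hdisj : Disjoint (M \ D) A := by
    rw [Finset.disjoint_left]
    intro e he heA
    induction e with
    | _ x y =>
      have hx : x ∉ holes D := by rw [← hDA]; exact not_mem_holes_left heA
      exact not_mem_holes_left he (hM.mem_holes_sdiff hD hx)
  rw [Finset.union_sdiff_cancel_right hdisj, Finset.sdiff_union_of_subset hD]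

/-- The state obtained from `M` by replacing its part `D` by another matching `A` of the same
vertices. -/
def State.switch (M : State G) (hD : D ⊆ M.1) (hA : IsMatching G A) (hDA : holes A = holes D) :
    State G :=
  ⟨M.1 \ D ∪ A, M.2.1.switch hD hA hDA, by rw [holes_switch hD hDA]; exact M.2.2⟩

theorem card_mul_sum_le_of_switch {T : Type*} [Fintype T] {A : T → Finset (Sym2 V)}
    (hA : ∀ s, IsMatching G (A s)) (hDA : ∀ s, holes (A s) = holes D)
    (hinj : Function.Injective A) {w : State G → ℝ} (hw : ∀ M, 0 ≤ w M)
    (hh : ∀ M N, holes M.1 = holes N.1 → w M = w N) :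
    Fintype.card T * ∑ M : State G with D ⊆ M.1, w M ≤ ∑ M, w M := by
  refine card_mul_sum_filter_le (Φ := fun M s => M.1.switch M.2 (hA s) (hDA s)) ?_ hw
    fun M s => hh _ _ (holes_switch M.2 (hDA s))
  intro M N s s' h
  have heq : M.1.1 \ D ∪ A s = N.1.1 \ D ∪ A s' := congrArg Subtype.val h
  have hmatch := M.1.2.1.switch M.2 (hA s) (hDA s)
  obtain rfl : s = s' := hinj (hmatch.eq_of_subset Finset.subset_union_right
    (heq ▸ Finset.subset_union_right) ((hDA s).trans (hDA s').symm))
  refine ⟨Subtype.ext (State.ext ?_), rfl⟩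
  rw [← M.1.2.1.switch_switch M.2 (hDA s), heq, N.1.2.1.switch_switch N.2 (hDA s)]

end Switch

/-! ### Bottleneck configurations -/

section RareConfigurations

variable {k : ℕ} {M : Finset (Sym2 (GVertex k))} {j c : Fin 4}

/-- The vertex of the graph that the vertex `p` of the `c`-th chain of boxes in the `j`-th copy of
the gadget becomes. -/
def chainCopy (k : ℕ) (j c : Fin 4) (p : BoxVertex k) : GVertex k := .copy j (chainMap k c p)

theorem chainCopy_injective (j c : Fin 4) : Function.Injective (chainCopy k j c) :=
  fun _ _ h => chainMap_injective c (GVertex.copy.inj h).2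

theorem chainCopy_of_not_isEnd (j c : Fin 4) {p : BoxVertex k} (hp : ¬ p.IsEnd) :
    chainCopy k j c p = inn j c ⟨p, hp⟩ := by rw [chainCopy, chainMap_of_not_isEnd c hp]

theorem chainCopy_of_isEnd (j c : Fin 4) {p : BoxVertex k} (hp : p.IsEnd) :
    chainCopy k j c p = cy j (hub c) ∨ chainCopy k j c p = cy j (tip c) := by
  rcases chainMap_of_isEnd c hp with h | h <;> simp [chainCopy, h]

theorem adj_chainCopy (j c : Fin 4) {p q : BoxVertex k} (h : (boxChain k).Adj p q) :
    (counterexampleGraph k).Adj (chainCopy k j c p) (chainCopy k j c q) :=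
  adj_copy_copy.2 ⟨rfl, gadget_adj_of_boxChain_adj c h⟩

theorem exists_chainCopy_eq (hk : 1 ≤ k) (j : Fin 4) {c : Fin 4} {m : Fin 12}
    (hm : m = hub c ∨ m = tip c) : ∃ p : BoxVertex k, chainCopy k j c p = cy j m := by
  have start_or_end : ∀ c m, m = hub c ∨ m = tip c → m = chainStart c ∨ m = chainEnd c := by decide
  rcases start_or_end c m hm with rfl | rfl
  · exact ⟨.v ⟨0, by omega⟩, by rw [chainCopy, chainMap_start c rfl]⟩
  · exact ⟨.v ⟨2 * k - 1, by omega⟩, by rw [chainCopy, chainMap_end c (by simp only; omega)]⟩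

theorem forall_ne_chainCopy_iff (hk : 1 ≤ k) {v : GVertex k} :
    (∀ p, v ≠ chainCopy k j c p) ↔
      (∀ p : BoxVertex k, ¬ p.IsEnd → v ≠ chainCopy k j c p) ∧
        v ≠ cy j (hub c) ∧ v ≠ cy j (tip c) := by
  constructor
  · intro h
    obtain ⟨p, hp⟩ := exists_chainCopy_eq hk j (Or.inl (Eq.refl (hub c)))
    obtain ⟨q, hq⟩ := exists_chainCopy_eq hk j (Or.inr (Eq.refl (tip c)))
    exact ⟨fun p _ => h p, hp ▸ h p, hq ▸ h q⟩
  · rintro ⟨hinner, hhub, htip⟩ p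
    by_cases hp : p.IsEnd
    · rcases chainCopy_of_isEnd j c hp with h | h <;> rw [h] <;> assumption
    · exact hinner p hp

/-- The part common to all matchings with `Rare M j c` that is to be switched. -/
def rarePart (k : ℕ) (j c : Fin 4) : Finset (Sym2 (GVertex k)) :=
  insert s(cy j (pole c), cy j (tip c)) (insert s(cy j (mid (c + 2)), cy j (tip (c + 2)))
    (insert s(cy j (hub c), cy j (hub (c + 2)))
      (involutionMatching (chainCopy k j c) (Finset.univ.filter fun p => ¬ p.IsEnd) innerPartner)))

/-- The matchings that replace `rarePart`. They leave the ends of the `c`-th chain of boxes to that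
chain, which can then be matched in `2 ^ k` ways instead of one. -/
def switchedPart (k : ℕ) (j c : Fin 4) (s : Fin k → Bool) : Finset (Sym2 (GVertex k)) :=
  insert s(cy j (pole c), cy j (tip (c + 2))) (insert s(cy j (mid (c + 2)), cy j (hub (c + 2)))
    (involutionMatching (chainCopy k j c) Finset.univ (boxPartner s)))

theorem holes_switchedPart (hk : 1 ≤ k) (j c : Fin 4) (s : Fin k → Bool) :
    holes (switchedPart k j c s) = holes (rarePart k j c) := by
  have hclosed : ∀ p ∈ Finset.univ.filter fun p : BoxVertex k => ¬ p.IsEnd,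
      innerPartner p ∈ Finset.univ.filter fun p : BoxVertex k => ¬ p.IsEnd := by
    simpa using fun p => not_isEnd_innerPartner (p := p)
  ext v
  have hends := forall_ne_chainCopy_iff hk (v := v) (j := j) (c := c)
  simp only [switchedPart, rarePart, holes_insert, Finset.mem_sdiff, Finset.mem_insert,
    Finset.mem_singleton, mem_holes_involutionMatching hclosed,
    mem_holes_involutionMatching fun p _ => Finset.mem_univ (boxPartner s p),
    Finset.mem_filter, Finset.mem_univ, true_and, true_imp_iff]
  tauto

theorem cy_mem_holes_involutionMatching {f : BoxVertex k → BoxVertex k} {m : Fin 12}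
    (hhub : m ≠ hub c) (htip : m ≠ tip c) :
    cy j m ∈ holes (involutionMatching (chainCopy k j c) Finset.univ f) := by
  rw [mem_holes_involutionMatching fun p _ => Finset.mem_univ _]
  intro p _ h
  by_cases hp : p.IsEnd
  · rcases chainCopy_of_isEnd j c hp with h' | h'
    exacts [hhub (by simpa [h'] using h), htip (by simpa [h'] using h)]
  · rw [chainCopy_of_not_isEnd j c hp] at h
    cases h

theorem isMatching_switchedPart (j c : Fin 4) (s : Fin k → Bool) :
    IsMatching (counterexampleGraph k) (switchedPart k j c s) := by
  have mid_hub : ∀ c, CycAdj (mid (c + 2)) (hub (c + 2)) := by decide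
  have pole_tip : ∀ c, CycAdj (pole c) (tip (c + 2)) := by decide
  have not_end : ∀ c, ∀ m ∈ [mid (c + 2), hub (c + 2), pole c, tip (c + 2)],
      m ≠ hub c ∧ m ≠ tip c := by decide
  have disjoint : ∀ c, ∀ m ∈ [pole c, tip (c + 2)], m ≠ mid (c + 2) ∧ m ≠ hub (c + 2) := by decide
  have hchain : IsMatching (counterexampleGraph k)
      (involutionMatching (chainCopy k j c) Finset.univ (boxPartner s)) :=
    isMatching_involutionMatching (chainCopy_injective j c) (fun p _ => boxPartner_boxPartner s p)
      fun p _ => adj_chainCopy j c (boxChain_adj_boxPartner s p)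
  have hhole : ∀ m ∈ [mid (c + 2), hub (c + 2), pole c, tip (c + 2)],
      cy j m ∈ holes (involutionMatching (chainCopy k j c) Finset.univ (boxPartner s)) :=
    fun m hm => cy_mem_holes_involutionMatching (not_end c m hm).1 (not_end c m hm).2
  have hmid := hchain.insert_edge (hhole (mid (c + 2)) (by simp)) (hhole (hub (c + 2)) (by simp))
    (adj_copy_copy.2 ⟨rfl, gadget_adj_of_cycAdj (mid_hub c)⟩)
  refine hmid.insert_edge ?_ ?_ (adj_copy_copy.2 ⟨rfl, gadget_adj_of_cycAdj (pole_tip c)⟩)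
  · rw [holes_insert, Finset.mem_sdiff]
    exact ⟨hhole _ (by simp), by simp [disjoint c (pole c)]⟩
  · rw [holes_insert, Finset.mem_sdiff]
    exact ⟨hhole _ (by simp), by simp [disjoint c (tip (c + 2))]⟩

theorem switchedPart_injective (j c : Fin 4) : Function.Injective (switchedPart k j c) := by
  intro s s' h
  have hedge : ∀ s i, s(chainCopy k j c (.a i), chainCopy k j c (boxPartner s (.a i))) ∈
      switchedPart k j c s := by
    intro s i
    refine Finset.mem_insert_of_mem (Finset.mem_insert_of_mem ?_)
    exact Finset.mem_image_of_mem _ (Finset.mem_univ _)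
  exact boxPartner_a_injective fun i => chainCopy_injective j c
    ((isMatching_switchedPart j c s).right_unique (hedge s i) (h ▸ hedge s' i))

theorem pole_twin_mem_exits (hk : 1 ≤ k) (hM : IsMatching (counterexampleGraph k) M)
    {r : GadgetVertex k} (hr : gadgetHoles M j = {r}) (hc : .cyc (pole c) ∉ exits M j) :
    .cyc (pole (twin c)) ∈ exits M j := by
  have pole_cases : ∀ c m, m = 3 ∨ m = 9 → m = pole c ∨ m = pole (twin c) := by decide
  by_contra htwin
  have heq : exits M j = {r} := by
    refine Finset.Subset.antisymm (fun s hs => ?_) (Finset.singleton_subset_iff.2 ?_)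
    · have hs' := exits_subset hM j hs
      rw [hr, Finset.mem_union] at hs'
      refine hs'.resolve_right fun hs' => ?_
      obtain ⟨m, hm, rfl⟩ : ∃ m : Fin 12, (m = 3 ∨ m = 9) ∧ s = .cyc m := by simpa using hs'
      rcases pole_cases c m hm with rfl | rfl
      exacts [hc hs, htwin hs]
    · exact mem_exits_of_mem_holes (mem_gadgetHoles.1 (hr ▸ Finset.mem_singleton_self r))
  have heven := even_card_exits hk hM j
  rw [heq, Finset.card_singleton] at heven
  exact absurd heven (by decide)

namespace Rare

theorem not_mem_holes (h : Rare M j c) {r : GadgetVertex k} (hr : r ≠ .cyc (mid c)) :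
    .copy j r ∉ holes M := by
  rw [← mem_gadgetHoles, h.1]
  simpa using hr

theorem tip_pole_not_mem (hk : 1 ≤ k) (hM : IsMatching (counterexampleGraph k) M)
    (h : Rare M j c) {c' : Fin 4} (hc' : c' ≠ c) : s(cy j (tip c'), cy j (pole c')) ∉ M := by
  have tip_injective : ∀ c c', tip c' = tip c → c' = c := by decide
  have pole_cases : ∀ c c', pole c' = pole c ∨ pole c' = pole (twin c) := by decide
  intro hmem
  rcases pole_cases c c' with hpole | hpole <;> rw [hpole] at hmem
  · have htip := hM.right_unique h.2 (Sym2.eq_swap ▸ hmem)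
    exact hc' (tip_injective _ _ (by simpa using htip.symm))
  · exact mem_exits.1 (pole_twin_mem_exits hk hM h.1 fun hc => mem_exits.1 hc _ h.2) _
      (Sym2.eq_swap ▸ hmem)

theorem mid_tip_mem (hk : 2 ≤ k) (hM : IsMatching (counterexampleGraph k) M)
    (h : Rare M j c) {c' : Fin 4} (hc' : c' ≠ c) : s(cy j (mid c'), cy j (tip c')) ∈ M := by
  have tip_ne_mid : ∀ c c', tip c' ≠ mid c := by decide
  have mid_injective : ∀ c c', mid c' = mid c → c' = c := by decide
  obtain ⟨y, hy⟩ := JSV.not_mem_holes.1 (h.not_mem_holes (r := .cyc (tip c'))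
    (by simpa using tip_ne_mid c c'))
  have hne : y ≠ cy j (pole c') := fun hyp => h.tip_pole_not_mem (by omega) hM hc' (hyp ▸ hy)
  have hmid : cy j (mid c') ∉ holes M :=
    h.not_mem_holes (by simpa using fun h => hc' (mid_injective _ _ h))
  rw [Sym2.eq_swap, ← eq_mid_of_tip_mem hk hM (fun p => h.not_mem_holes (by simp)) hmid hy hne]
  exact hy

theorem tip_inn_not_mem (hM : IsMatching (counterexampleGraph k) M) (h : Rare M j c) :
    ¬ ∃ p, s(cy j (tip c), inn j c p) ∈ M := by
  rintro ⟨p, hp⟩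
  cases hM.right_unique hp (Sym2.eq_swap ▸ h.2)

theorem hub_inn_not_mem (hk : 1 ≤ k) (hM : IsMatching (counterexampleGraph k) M)
    (h : Rare M j c) : ¬ ∃ p, s(cy j (hub c), inn j c p) ∈ M := fun hmem =>
  h.tip_inn_not_mem hM
    ((hub_matched_iff_tip_matched hk hM fun _ => h.not_mem_holes (by simp)).1 hmem)

theorem hub_hub_mem (hk : 2 ≤ k) (hM : IsMatching (counterexampleGraph k) M) (h : Rare M j c) :
    s(cy j (hub c), cy j (hub (c + 2))) ∈ M := by
  have hub_ne : ∀ c c', hub c ≠ mid c' ∧ hub c ≠ tip c' := by decide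
  have twin_ne : ∀ c, twin c ≠ c := by decide
  have hub_twin : ∀ c, hub (twin c) = hub c := by decide
  have htwin := h.mid_tip_mem hk hM (twin_ne c)
  obtain ⟨y, hy⟩ := JSV.not_mem_holes.1 (h.not_mem_holes (r := .cyc (hub c))
    (by simpa using (hub_ne c c).1))
  rcases adj_hub_cases hk (hM.adj hy) with rfl | rfl | rfl | ⟨p, rfl⟩ | ⟨p, rfl⟩
  · exact absurd (mem_gadgetHoles.1 (by simp [h.1])) (not_mem_holes_right hy)
  · have := hM.right_unique htwin (Sym2.eq_swap ▸ hy)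
    exact absurd (by simpa using this.symm) (hub_ne c (twin c)).2
  · exact hy
  · exact absurd ⟨p, hy⟩ (h.hub_inn_not_mem (by omega) hM)
  · obtain ⟨q, hq⟩ := (hub_matched_iff_tip_matched (c := twin c) (by omega) hM
      fun _ => h.not_mem_holes (by simp)).1 ⟨p, by rwa [hub_twin]⟩
    cases hM.right_unique hq (Sym2.eq_swap ▸ htwin)

theorem matchesInner (hk : 1 ≤ k) (hM : IsMatching (counterexampleGraph k) M) (h : Rare M j c) :
    MatchesInner fun p q => s(chainCopy k j c p, chainCopy k j c q) ∈ M where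
  symm p q hpq := Sym2.eq_swap ▸ hpq
  right_unique p q q' hq hq' := chainCopy_injective j c (hM.right_unique hq hq')
  exists_adj p hp := by
    obtain ⟨y, hy⟩ := JSV.not_mem_holes.1 (h.not_mem_holes (r := .inner c ⟨p, hp⟩) (by simp))
    obtain ⟨q, hadj, rfl⟩ := exists_boxChain_adj_of_adj_inn (hM.adj hy)
    refine ⟨q, fun hq => ?_, hadj, by rw [chainCopy_of_not_isEnd j c hp]; exact hy⟩
    have hy : s(chainCopy k j c q, inn j c ⟨p, hp⟩) ∈ M := Sym2.eq_swap ▸ hy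
    rcases chainCopy_of_isEnd j c hq with h' | h' <;> rw [h'] at hy
    exacts [h.hub_inn_not_mem hk hM ⟨_, hy⟩, h.tip_inn_not_mem hM ⟨_, hy⟩]

theorem rarePart_subset (hk : 2 ≤ k) (hM : IsMatching (counterexampleGraph k) M)
    (h : Rare M j c) : rarePart k j c ⊆ M := by
  have add_two_ne : ∀ c : Fin 4, c + 2 ≠ c := by decide
  have hinner : involutionMatching (chainCopy k j c) (Finset.univ.filter fun p => ¬ p.IsEnd)
      innerPartner ⊆ M := by
    intro e he
    obtain ⟨p, hp, rfl⟩ := Finset.mem_image.1 he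
    exact (h.matchesInner (by omega) hM).rel_innerPartner (Finset.mem_filter.1 hp).2
  simp only [rarePart, Finset.insert_subset_iff]
  exact ⟨h.2, h.mid_tip_mem hk hM (add_two_ne c), h.hub_hub_mem hk hM, hinner⟩

end Rare

open Classical in
theorem two_pow_mul_sum_rare_le (hk : 2 ≤ k) {w : State (counterexampleGraph k) → ℝ}
    (hw : ∀ M, 0 ≤ w M) (hh : ∀ M N, holes M.1 = holes N.1 → w M = w N) (j c : Fin 4) :
    2 ^ k * ∑ M : State (counterexampleGraph k) with Rare M.1 j c, w M ≤ ∑ M, w M := by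
  have hswitch := card_mul_sum_le_of_switch (D := rarePart k j c) (isMatching_switchedPart j c)
    (holes_switchedPart (by omega) j c) (switchedPart_injective j c) hw hh
  rw [Fintype.card_fun, Fintype.card_bool, Fintype.card_fin, Nat.cast_pow, Nat.cast_ofNat]
    at hswitch
  refine (mul_le_mul_of_nonneg_left ?_ (by positivity)).trans hswitch
  refine Finset.sum_le_sum_of_subset_of_nonneg ?_ fun M _ _ => hw M
  intro M hM
  rw [Finset.mem_filter] at hM ⊢
  exact ⟨Finset.mem_univ _, hM.2.rarePart_subset hk M.2.1⟩

end RareConfigurations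

/-! ### A perfect matching -/

section PerfectMatching

variable {k : ℕ}

/-- The matching of the twelve-cycle without `u` and `v` that uses the chord `{a, b}`. The values at
`u` and `v` are irrelevant. -/
def chordMatching : Fin 12 → Fin 12 := ![6, 2, 1, 3, 5, 4, 0, 8, 7, 9, 11, 10]

/-- A perfect matching of the twelve-cycle. -/
def cycleMatching : Fin 12 → Fin 12 := ![1, 0, 3, 2, 5, 4, 7, 6, 9, 8, 11, 10]

/-- A perfect matching of the graph, as an involution. The copies of the gadget with even index have
their vertices `u` and `v` matched to the outside. -/
def partner : GVertex k → GVertex k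
  | .t i => if Even (i : ℕ) then cy i 3 else cy (i - 1) 9
  | .copy j (.cyc m) => if Even (j : ℕ) then
      (if m = 3 then .t j else if m = 9 then .t (j + 1) else cy j (chordMatching m))
      else cy j (cycleMatching m)
  | .copy j (.inner c p) => inn j c ⟨innerPartner p.1, not_isEnd_innerPartner p.2⟩

theorem partner_t (i : Fin 4) :
    partner (k := k) (.t i) = if Even (i : ℕ) then cy i 3 else cy (i - 1) 9 := rfl

theorem partner_cy (j : Fin 4) (m : Fin 12) : partner (k := k) (cy j m) =
    if Even (j : ℕ) then
      (if m = 3 then .t j else if m = 9 then .t (j + 1) else cy j (chordMatching m))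
      else cy j (cycleMatching m) := rfl

theorem partner_partner (x : GVertex k) : partner (partner x) = x := by
  have even_sub_one : ∀ i : Fin 4, ¬ Even (i : ℕ) → Even ((i - 1 : Fin 4) : ℕ) := by decide
  have not_even_add_one : ∀ i : Fin 4, Even (i : ℕ) → ¬ Even ((i + 1 : Fin 4) : ℕ) := by decide
  have chord : ∀ m : Fin 12, m ≠ 3 → m ≠ 9 → chordMatching m ≠ 3 ∧ chordMatching m ≠ 9 ∧
      chordMatching (chordMatching m) = m := by decide
  have cycle : ∀ m : Fin 12, cycleMatching (cycleMatching m) = m := by decide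
  rcases x with i | ⟨j, m | ⟨c, p⟩⟩
  · rw [partner_t]
    split_ifs with hi
    · rw [partner_cy, if_pos hi, if_pos rfl]
    · rw [partner_cy, if_pos (even_sub_one i hi), if_neg (by decide), if_pos rfl, sub_add_cancel]
  · rw [partner_cy]
    split_ifs with hj h3 h9
    · rw [partner_t, if_pos hj, h3]
    · rw [partner_t, if_neg (not_even_add_one j hj), h9, add_sub_cancel_right]
    · obtain ⟨h3', h9', hm⟩ := chord m h3 h9
      rw [partner_cy, if_pos hj, if_neg h3', if_neg h9', hm]
    · rw [partner_cy, if_neg hj, cycle]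
  · simp only [partner, inn, innerPartner_innerPartner]

theorem adj_partner (x : GVertex k) : (counterexampleGraph k).Adj x (partner x) := by
  have chord : ∀ m : Fin 12, m ≠ 3 → m ≠ 9 → CycAdj m (chordMatching m) := by decide
  have cycle : ∀ m : Fin 12, CycAdj m (cycleMatching m) := by decide
  rcases x with i | ⟨j, m | ⟨c, p⟩⟩
  · rw [partner_t]
    split_ifs <;> simp
  · rw [partner_cy]
    split_ifs with hj h3 h9
    · rw [SimpleGraph.adj_comm, h3]; simp
    · rw [SimpleGraph.adj_comm, h9]; simp
    · exact adj_copy_copy.2 ⟨rfl, gadget_adj_of_cycAdj (chord m h3 h9)⟩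
    · exact adj_copy_copy.2 ⟨rfl, gadget_adj_of_cycAdj (cycle m)⟩
  · refine adj_copy_copy.2 ⟨rfl, gadget_adj_inner.2
      ⟨innerPartner p.1, boxChain_adj_innerPartner p.2, ?_⟩⟩
    rw [chainMap_of_not_isEnd c (not_isEnd_innerPartner p.2)]

theorem exists_perfect (k : ℕ) : ∃ P : State (counterexampleGraph k), holes P.1 = ∅ := by
  have hM : IsMatching (counterexampleGraph k) (involutionMatching id Finset.univ partner) :=
    isMatching_involutionMatching Function.injective_id (fun p _ => partner_partner p)
      fun p _ => adj_partner p
  have hh : holes (involutionMatching (id : GVertex k → GVertex k) Finset.univ partner) = ∅ := by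
    refine Finset.eq_empty_of_forall_notMem fun v hv => ?_
    rw [mem_holes_involutionMatching fun p _ => Finset.mem_univ _] at hv
    exact hv v (Finset.mem_univ _) rfl
  exact ⟨⟨_, hM, Or.inl (by rw [hh, Finset.card_empty])⟩, hh⟩

end PerfectMatching

/-! ### Rotation -/

section Isomorphisms

variable {V W : Type*} {G : SimpleGraph V} {G' : SimpleGraph W} {M : Finset (Sym2 V)}
  [DecidableEq W]

theorem IsMatching.image (hM : IsMatching G M) (f : G ↪g G') :
    IsMatching G' (M.image (Sym2.map f)) := by
  refine ⟨Finset.forall_mem_image.2 fun e he => f.map_mem_edgeSet_iff.2 (hM.1 e he),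
    Finset.forall_mem_image.2 fun e he => Finset.forall_mem_image.2 fun e' he' v hv hv' => ?_⟩
  obtain ⟨x, hx, rfl⟩ := Sym2.mem_map.1 hv
  obtain ⟨y, hy, hyx⟩ := Sym2.mem_map.1 hv'
  rw [hM.2 e he e' he' x hx (f.injective hyx ▸ hy)]

theorem holes_image [Fintype V] [DecidableEq V] [Fintype W] {f : V → W}
    (hf : Function.Bijective f) : holes (M.image (Sym2.map f)) = (holes M).image f := by
  ext v
  obtain ⟨x, rfl⟩ := hf.2 v
  rw [hf.1.mem_finset_image, mem_holes, mem_holes, Finset.forall_mem_image]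
  refine forall₂_congr fun e _ => not_congr ?_
  rw [Sym2.mem_map]
  exact ⟨fun ⟨y, hy, hyx⟩ => hf.1 hyx ▸ hy, fun hx => ⟨x, hx, rfl⟩⟩

theorem image_map_image_map [DecidableEq V] {f : V → W} {g : W → V} (h : Function.LeftInverse g f) :
    (M.image (Sym2.map f)).image (Sym2.map g) = M := by
  rw [Finset.image_image, ← Sym2.map_comp, h.comp_eq_id, Sym2.map_id, Finset.image_id]

/-- The bijection between the state spaces of isomorphic graphs. -/
def State.equivOfIso [Fintype V] [DecidableEq V] [Fintype W] (f : G ≃g G') :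
    State G ≃ State G' where
  toFun M := ⟨M.1.image (Sym2.map f), M.2.1.image f.toEmbedding, by
    rw [holes_image f.bijective, Finset.card_image_of_injective _ f.injective]; exact M.2.2⟩
  invFun M := ⟨M.1.image (Sym2.map f.symm), M.2.1.image f.symm.toEmbedding, by
    rw [holes_image f.symm.bijective, Finset.card_image_of_injective _ f.symm.injective]
    exact M.2.2⟩
  left_inv M := State.ext (image_map_image_map f.left_inv)
  right_inv M := State.ext (image_map_image_map f.right_inv)

end Isomorphisms

section Rotation

variable {k : ℕ} {M : Finset (Sym2 (GVertex k))}

/-- The automorphism of the graph that moves the `j`-th copy of the gadget to the `(j + 1)`-st. -/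
def rotation (k : ℕ) : counterexampleGraph k ≃g counterexampleGraph k where
  toFun
    | .t i => .t (i + 1)
    | .copy j r => .copy (j + 1) r
  invFun
    | .t i => .t (i - 1)
    | .copy j r => .copy (j - 1) r
  left_inv := by rintro (i | ⟨j, r⟩) <;> simp
  right_inv := by rintro (i | ⟨j, r⟩) <;> simp
  map_rel_iff' := by
    rintro (i | ⟨j, r⟩) (i' | ⟨j', r'⟩)
    · simp
    · simp [eq_sub_iff_add_eq]
    · rw [SimpleGraph.adj_comm, SimpleGraph.adj_comm _ (GVertex.copy j r)]
      simp [eq_sub_iff_add_eq]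
    · simp

theorem exits_rotation (j : Fin 4) :
    exits (M.image (Sym2.map (rotation k))) (j + 1) = exits M j := by
  ext r
  rw [mem_exits, mem_exits]
  exact forall_congr' fun s => not_congr
    ((Sym2.map.injective (rotation k).injective).mem_finset_image (a := s(.copy j r, .copy j s)))

theorem mem_agree_rotation {j : Fin 4} :
    j + 1 ∈ agree (M.image (Sym2.map (rotation k))) ↔ j ∉ agree M := by
  have even_add_one : ∀ j : Fin 4, Even ((j + 1 : Fin 4) : ℕ) ↔ ¬ Even (j : ℕ) := by decide
  rw [mem_agree, mem_agree, even_add_one, Flag, exits_rotation, ← Flag]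
  tauto

theorem card_agree_rotation (M : Finset (Sym2 (GVertex k))) :
    (agree M).card + (agree (M.image (Sym2.map (rotation k)))).card = 4 := by
  have h : agree (M.image (Sym2.map (rotation k))) = (agree M)ᶜ.image (· + 1) := by
    ext j
    obtain ⟨i, rfl⟩ := add_right_surjective (1 : Fin 4) j
    rw [mem_agree_rotation, (add_left_injective 1).mem_finset_image, Finset.mem_compl]
  rw [h, Finset.card_image_of_injective _ (add_left_injective 1), Finset.card_add_card_compl,
    Fintype.card_fin]

/-- The states with at least three copies of the gadget in `agree`: one side of the cut. -/
def side (k : ℕ) : Finset (State (counterexampleGraph k)) :=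
  Finset.univ.filter fun M => 3 ≤ (agree M.1).card

theorem mem_side {M : State (counterexampleGraph k)} : M ∈ side k ↔ 3 ≤ (agree M.1).card := by
  rw [side, Finset.mem_filter, and_iff_right (Finset.mem_univ _)]

theorem mem_perfectMatchings {V : Type*} [Fintype V] [DecidableEq V] {G : SimpleGraph V}
    {M : State G} : M ∈ perfectMatchings G ↔ holes M.1 = ∅ := by
  rw [perfectMatchings, Finset.mem_filter, and_iff_right (Finset.mem_univ _)]

theorem sum_perfectMatchings_inter_side (hk : 1 ≤ k) {w : State (counterexampleGraph k) → ℝ}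
    (hh : ∀ M N, holes M.1 = holes N.1 → w M = w N) :
    ∑ M ∈ perfectMatchings (counterexampleGraph k) ∩ side k, w M =
      ∑ M ∈ perfectMatchings (counterexampleGraph k) \ side k, w M := by
  have hholes : ∀ M : State (counterexampleGraph k),
      holes (State.equivOfIso (rotation k) M).1 = (holes M.1).image (rotation k) :=
    fun M => holes_image (rotation k).bijective
  refine Finset.sum_equiv (State.equivOfIso (rotation k)) (fun M => ?_) fun M hM => hh _ _ ?_
  · rw [Finset.mem_inter, Finset.mem_sdiff, mem_perfectMatchings, mem_perfectMatchings, mem_side,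
      mem_side, hholes, Finset.image_eq_empty]
    refine and_congr_right fun hM => ?_
    have hne := card_agree_ne_two hk M.2.1 hM
    have hsum := card_agree_rotation M.1
    change _ ↔ ¬ 3 ≤ (agree (M.1.image (Sym2.map (rotation k)))).card
    omega
  · rw [hholes, mem_perfectMatchings.1 (Finset.mem_inter.1 hM).1, Finset.image_empty]

end Rotation

/-! ### The bound on the mixing time -/

section Bottleneck

variable {k : ℕ}

open Classical in
theorem sum_filter_exists_le {S Q : Type*} [Fintype S] [Fintype Q] (p : Q → S → Prop) {w : S → ℝ}
    (hw : ∀ i, 0 ≤ w i) : ∑ i with ∃ q, p q i, w i ≤ ∑ q, ∑ i with p q i, w i := by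
  simp_rw [Finset.sum_filter]
  rw [Finset.sum_comm]
  have hnonneg : ∀ i q, 0 ≤ if p q i then w i else 0 := fun i q => by
    split_ifs
    exacts [hw i, le_rfl]
  refine Finset.sum_le_sum fun i _ => ?_
  split_ifs with h
  · obtain ⟨q, hq⟩ := h
    calc w i = if p q i then w i else 0 := (if_pos hq).symm
      _ ≤ ∑ q, if p q i then w i else 0 :=
        Finset.single_le_sum (fun q _ => hnonneg i q) (Finset.mem_univ q)
  · exact Finset.sum_nonneg fun q _ => hnonneg i q

open Classical in
/-- The states in which some copy of the gadget is in a bottleneck configuration. -/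
def rareStates (k : ℕ) : Finset (State (counterexampleGraph k)) :=
  Finset.univ.filter fun M => ∃ q : Fin 4 × Fin 4, Rare M.1 q.1 q.2

open Classical in
theorem mem_rareStates {M : State (counterexampleGraph k)} :
    M ∈ rareStates k ↔ ∃ j c, Rare M.1 j c := by
  rw [rareStates, Finset.mem_filter, and_iff_right (Finset.mem_univ _), Prod.exists]

open Classical in
theorem two_pow_mul_sum_rareStates_le (hk : 2 ≤ k) {w : State (counterexampleGraph k) → ℝ}
    (hw : ∀ M, 0 ≤ w M) (hh : ∀ M N, holes M.1 = holes N.1 → w M = w N) :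
    2 ^ k * ∑ M ∈ rareStates k, w M ≤ 16 * ∑ M, w M := by
  calc 2 ^ k * ∑ M ∈ rareStates k, w M
      ≤ 2 ^ k * ∑ q : Fin 4 × Fin 4, ∑ M : State (counterexampleGraph k) with Rare M.1 q.1 q.2,
          w M := by
        refine mul_le_mul_of_nonneg_left ?_ (by positivity)
        exact sum_filter_exists_le (fun (q : Fin 4 × Fin 4) (M : State (counterexampleGraph k)) =>
          Rare M.1 q.1 q.2) hw
    _ = ∑ q : Fin 4 × Fin 4, 2 ^ k * ∑ M : State (counterexampleGraph k) with Rare M.1 q.1 q.2,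
          w M := Finset.mul_sum _ _ _
    _ ≤ ∑ _q : Fin 4 × Fin 4, ∑ M, w M := by
        refine Finset.sum_le_sum fun q _ => ?_
        exact two_pow_mul_sum_rare_le hk hw hh q.1 q.2
    _ = 16 * ∑ M, w M := by simp

theorem mem_rareStates_of_crossing (hk : 2 ≤ k) {M N : State (counterexampleGraph k)}
    (h : BroderStep (counterexampleGraph k) M.1 N.1) (hM : M ∈ side k) (hN : N ∉ side k) :
    M ∈ rareStates k ∨ N ∈ rareStates k := by
  contrapose! hN
  simp only [mem_rareStates, not_exists] at hN
  exact mem_side.2 (h.three_le_card_agree hk M.2.1 N.2.1 M.card_holes_le_two N.card_holes_le_two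
    hN.1 hN.2 (mem_side.1 hM))

theorem two_pow_mul_sum_perfectMatchings_le (hk : 2 ≤ k) {w : State (counterexampleGraph k) → ℝ}
    (hw : ∀ M, 0 < w M) (hh : ∀ M N, holes M.1 = holes N.1 → w M = w N)
    {π : State (counterexampleGraph k) → ℝ}
    (hst : IsStationary (metropolis (counterexampleGraph k) w) π) {t : ℕ}
    (ht : mixingTime (metropolis (counterexampleGraph k) w) π ≤ t) :
    2 ^ k * ∑ M ∈ perfectMatchings (counterexampleGraph k), π M ≤ 128 * t := by
  have : Nonempty (GVertex k) := ⟨.t 0⟩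
  obtain ⟨Q, hQ⟩ := exists_perfect k
  have hπh : ∀ M N, holes M.1 = holes N.1 → π M = π N := by
    intro M N h
    simp only [metropolis_eq_of_isStationary hw hQ hst, hh M N h]
  have hrare : 2 ^ k * ∑ M ∈ rareStates k, π M ≤ 16 := by
    simpa only [hst.1.2, mul_one] using two_pow_mul_sum_rareStates_le hk hst.1.1 hπh
  have hmix : ∑ M ∈ perfectMatchings (counterexampleGraph k), π M ≤
      8 * (t * ∑ M ∈ rareStates k, π M) :=
    hst.sum_le_of_bisected (metropolis_mem_rowStochastic hw)
      (sum_perfectMatchings_inter_side (by omega) hπh)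
      (fun M hM N hN hne => mem_rareStates_of_crossing hk
        (step_of_metropolis_ne_zero (fun h => hN (h ▸ hM)) hne) hM hN) ht
  calc 2 ^ k * ∑ M ∈ perfectMatchings (counterexampleGraph k), π M
      ≤ 2 ^ k * (8 * (t * ∑ M ∈ rareStates k, π M)) :=
        mul_le_mul_of_nonneg_left hmix (by positivity)
    _ = 8 * t * (2 ^ k * ∑ M ∈ rareStates k, π M) := by ring
    _ ≤ 8 * t * 16 := mul_le_mul_of_nonneg_left hrare (by positivity)
    _ = 128 * t := by ring

end Bottleneck

theorem exp_mul_le_two_pow {k : ℕ} (hk : 20 ≤ k) :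
    128 * Real.exp (2 * (1 / 1000 * ((64 * k + 20 : ℕ) : ℝ))) ≤ 2 ^ k := by
  have hexp : ∀ n : ℕ, (2 : ℝ) ^ n = Real.exp (n * Real.log 2) := fun n => by
    rw [Real.exp_nat_mul, Real.exp_log two_pos]
  have h128 : (128 : ℝ) = Real.exp ((7 : ℕ) * Real.log 2) := by rw [← hexp]; norm_num
  have hk' : (20 : ℝ) ≤ k := by exact_mod_cast hk
  rw [h128, hexp, ← Real.exp_add, Real.exp_le_exp]
  push_cast
  nlinarith [mul_nonneg (sub_nonneg.2 hk') (sub_nonneg.2 Real.log_two_gt_d9.le),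
    Real.log_two_gt_d9]

theorem le_exp_neg_or_exp_le {a b x p t : ℝ} (ha : 0 < a) (hb : a * Real.exp (2 * x) ≤ b)
    (h : b * p ≤ a * t) : p ≤ Real.exp (-x) ∨ Real.exp x ≤ t := by
  refine or_iff_not_imp_left.2 fun hp => le_of_mul_le_mul_left ?_ ha
  have hb0 : 0 ≤ b := (by positivity : 0 ≤ a * Real.exp (2 * x)).trans hb
  calc a * Real.exp x = a * Real.exp (2 * x) * Real.exp (-x) := by
        rw [mul_assoc, ← Real.exp_add]; congr 2; ring
    _ ≤ b * Real.exp (-x) := mul_le_mul_of_nonneg_right hb (Real.exp_pos _).le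
    _ ≤ b * p := mul_le_mul_of_nonneg_left (not_le.1 hp).le hb0
    _ ≤ a * t := h

theorem ofReal_le_toENNReal_of_forall {x : ℝ} {T : ℕ∞} (h : ∀ t : ℕ, T ≤ t → x ≤ t) :
    ENNReal.ofReal x ≤ (T : ℝ≥0∞) := by
  induction T using ENat.recTopCoe with
  | top => simp
  | coe t =>
    rw [ENat.toENNReal_coe, ENNReal.ofReal_le_natCast]
    exact h t le_rfl

end JSV

end

theorem theorem1 :
    (∀ k : ℕ, 1 ≤ k → Fintype.card (JSV.GVertex k) = 64 * k + 20) ∧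
    ∃ c : ℝ, 0 < c ∧ ∃ K : ℕ, 1 ≤ K ∧ ∀ k : ℕ, K ≤ k →
      ∀ P : Matrix (JSV.State (JSV.counterexampleGraph k))
          (JSV.State (JSV.counterexampleGraph k)) ℝ,
        JSV.IsJSVType (JSV.counterexampleGraph k) P →
        ∃ π : JSV.State (JSV.counterexampleGraph k) → ℝ,
          JSV.IsStationary P π ∧ (∀ π', JSV.IsStationary P π' → π' = π) ∧
          (∑ M ∈ JSV.perfectMatchings (JSV.counterexampleGraph k), π M
              ≤ Real.exp (-(c * (Fintype.card (JSV.GVertex k) : ℝ))) ∨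
            ENNReal.ofReal (Real.exp (c * (Fintype.card (JSV.GVertex k) : ℝ)))
              ≤ (JSV.mixingTime P π : ENNReal)) := by
  refine ⟨fun k hk => JSV.card_gVertex hk, 1 / 1000, by norm_num, 20, by norm_num, ?_⟩
  rintro k hk _ ⟨w, hw, hh, rfl⟩
  have : Nonempty (JSV.GVertex k) := ⟨.t 0⟩
  obtain ⟨Q, hQ⟩ := JSV.exists_perfect k
  have : Nonempty (JSV.State (JSV.counterexampleGraph k)) := ⟨Q⟩
  have hst := JSV.metropolis_isStationary hw
  refine ⟨_, hst, fun π' => JSV.metropolis_eq_of_isStationary hw hQ, ?_⟩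
  refine or_iff_not_imp_left.2 fun hperfect => JSV.ofReal_le_toENNReal_of_forall fun t ht => ?_
  have hpow := JSV.exp_mul_le_two_pow hk
  rw [← JSV.card_gVertex (by omega)] at hpow
  have hmix := JSV.two_pow_mul_sum_perfectMatchings_le (by omega) hw hh hst ht
  exact (JSV.le_exp_neg_or_exp_le (by norm_num) hpow hmix).resolve_left hperfect
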